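/- Let $p$ be a prime, $n,m\ge 1$ integers, $\mathbb F=\mathrm{GF}(p^n)$, and $G=U(p^n-1)/\langle p\rangle$, where $U(p^n-1)$ is the group of units modulo $p^n-1$. A *near-vector space* is a pair $(V,A)$ of a group $(V,+)$ and a set $A$ of endomorphisms of $V$ (acting on the right) such that $0,\mathrm{id},-\mathrm{id}\in A$; $A^*=A\setminus\{0\}$ is a subgroup of $\mathrm{Aut}(V)$; $x\alpha=x\beta$ with $x\in V$, $\alpha,\beta\in A$ implies $x=0$ or $\alpha=\beta$; and $\{x\in V:\forall\alpha,\beta\in A\ \exists\gamma\in A,\ x\alpha+x\beta=x\gamma\}$ generates $V$. Two near-vector spaces $(V_1,A_1)$, $(V_2,A_2)$ are *isomorphic* if there are group isomorphisms $\theta:V_1\to V_2$ and $\eta:A_1^*\to A_2^*$ with $\theta(x\alpha)=\theta(x)\eta(\alpha)$ for all $x\in V_1$, $\alpha\in A_1^*$. The *near-vector spaces $\mathbb F^{\oplus m}$ over $\mathbb F$* are the near-vector spaces $(\mathbb F^{\oplus m},A)$ with $A=\{s_\alpha:\alpha\in\mathbb F\}$, $(x_1,\dots,x_m)s_\alpha=(x_1\psi_1(\alpha),\dots,x_m\psi_m(\alpha))$,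 for some automorphisms $\psi_1,\dots,\psi_m$ of the semigroup $(\mathbb F,\cdot)$. Identify each element of $G$ with its smallest representative in $\{1,\dots,p^n-1\}$. A *suitable sequence* is a non-decreasing sequence $(S)=(q_1,\dots,q_m)$ in $G$; $S$ denotes its set of entries. It determines the near-vector space $\mathbb F^{\oplus m}$ with $(x_1,\dots,x_m)s_\alpha=(x_1\alpha^{q_1},\dots,x_m\alpha^{q_m})$; write $(S)\sim(S')$ if the near-vector spaces so determined are isomorphic, and let $[(S)]$ be the $\sim$-class of $(S)$ among the suitable sequences of length $m$ with $1$ in the first position. For $1\le N\le\min(m,|G|)$ let $T(N)$ be the number of $\sim$-classes of suitable sequences of length $m$ with $1$ in the first position and $|S|=N$. For a subgroup $H\le G$ with $|H|$ dividing $\gcd(m,N,|G|)$ let $St(H,m,N)$ be the set of suitable sequences $(S)$ of length $m$ with $|S|=N$ such that $H\subseteq S$, $S$ is a union of cosets of $H$, and entries from the same coset of $H$ occur equally often in $(S)$; and let $\overline S(H)=\{(S)\in St(H,m,N): |[(S)]|=N/|H|\}$. For $d\mid\gcd(m,N,|G|)$ put $$t(N,d)=\binom{|G|/d-1}{N/d-1}\binom{m/d-1}{N/d-1},\qquad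 t_N=t(N,1)=\binom{|G|-1}{N-1}\binom{m-1}{N-1}.$$ Then the number of near-vector spaces $\mathbb F^{\oplus m}$ over $\mathbb F$ up to isomorphism is $\sum_{N=1}^{\min(m,|G|)}T(N)$, and for each such $N$ $$T(N)=\frac{t_N}{N}+\frac1N\sum_{\substack{d\mid D\\ d>1}}(d-1)\sum_{\substack{H\le G\\ |H|=d}}|\overline S(H)|,\qquad D=\gcd(m,N,|G|),$$ where the numbers $|\overline S(H)|$ are given recursively by $|\overline S(H)|=t(N,D)$ for $|H|=D$, and, for $|H|\mid D$ with $|H|<D$, $$|\overline S(H)|=t(N,|H|)-\sum_{\substack{d\mid D\\ |H|<d<D}}\ \sum_{\substack{H\le K\le G\\ |K|=d}}|\overline S(K)|-\bigl|\{K\le G: H\le K,\ |K|=D\}\bigr|\;t(N,D).$$ -/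

import Mathlib

namespace NearVec

/-- A near-vector space structure on an additive group `V`: a set of endomorphisms of `V`
(the scalars) subject to the axioms. The automorphism group of `V` is the group of units of its
endomorphism monoid; `units` is the subgroup formed by the nonzero scalars, and it is determined
by `scalars` through `coe_units`. -/
structure NearVectorSpace (V : Type*) [AddGroup V] where
  /-- the set `A` of scalars -/
  scalars : Set (AddMonoid.End V)
  zero_mem : (0 : V →+ V) ∈ scalars
  id_mem : (1 : AddMonoid.End V) ∈ scalars
  neg_id_mem : ∃ f ∈ scalars, ∀ x, f x = -x
  /-- the group `A* = A \ {0}`, as a subgroup of `Aut V` -/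
  units : Subgroup (AddMonoid.End V)ˣ
  coe_units : ∀ f : AddMonoid.End V,
    (∃ u ∈ units, (u : AddMonoid.End V) = f) ↔ f ∈ scalars ∧ f ≠ (0 : V →+ V)
  fixedPointFree : ∀ x : V, ∀ f ∈ scalars, ∀ g ∈ scalars, f x = g x → x = 0 ∨ f = g
  /-- the quasi-kernel generates `V` as a group -/
  closure_quasiKernel :
    AddSubgroup.closure {x : V | ∀ f ∈ scalars, ∀ g ∈ scalars, ∃ h ∈ scalars, f x + g x = h x} = ⊤

/-- Isomorphism of near-vector spaces. -/
def NearVectorSpace.Iso {V W : Type*} [AddGroup V] [AddGroup W]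
    (A : NearVectorSpace V) (B : NearVectorSpace W) : Prop :=
  ∃ (θ : V ≃+ W) (η : A.units ≃* B.units), ∀ (x : V) (a : A.units),
    θ (((a : (AddMonoid.End V)ˣ) : AddMonoid.End V) x) =
      ((η a : (AddMonoid.End W)ˣ) : AddMonoid.End W) (θ x)

/-- The endomorphism `(x₁, …, x_m) ↦ (x₁ c₁, …, x_m c_m)` of the additive group `F^m`. -/
def diagEnd {F : Type*} [Field F] {m : ℕ} (c : Fin m → F) :
    AddMonoid.End (Fin m → F) where
  toFun x i := x i * c i
  map_zero' := by ext i; simp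
  map_add' x y := by ext i; simp [add_mul]

@[simp]
theorem diagEnd_apply {F : Type*} [Field F] {m : ℕ} (c x : Fin m → F) (i : Fin m) :
    diagEnd c x i = x i * c i := rfl

/-- The near-vector spaces `F^m` over the field `F`: those whose scalars are the maps
`s_α : (x₁, …, x_m) ↦ (x₁ ψ₁(α), …, x_m ψ_m(α))`, `α ∈ F`, for some automorphisms `ψ₁, …, ψ_m`
of the multiplicative semigroup of `F`. -/
def OverField (F : Type*) [Field F] (m : ℕ) : Type _ :=
  {A : NearVectorSpace (Fin m → F) //
    ∃ ψ : Fin m → (F ≃* F), A.scalars = Set.range fun α : F => diagEnd fun i => ψ i α}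

/-- Isomorphism as an equivalence relation on the near-vector spaces `F^m` over `F`. -/
def isoSetoid (F : Type*) [Field F] (m : ℕ) : Setoid (OverField F m) where
  r A B := A.1.Iso B.1
  iseqv :=
    { refl := fun _ => ⟨AddEquiv.refl _, MulEquiv.refl _, fun _ _ => rfl⟩
      symm := by
        rintro A B ⟨θ, η, h⟩
        refine ⟨θ.symm, η.symm, fun x a => ?_⟩
        apply θ.injective
        rw [h]
        simp
      trans := by
        rintro A B C ⟨θ, η, h⟩ ⟨θ', η', h'⟩
        refine ⟨θ.trans θ', η.trans η', fun x a => ?_⟩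
        simp [h, h'] }

/-- The number of near-vector spaces `F^m` over `F` up to isomorphism. -/
noncomputable def numNearVectorSpaces (F : Type*) [Field F] (m : ℕ) : ℕ :=
  Nat.card (Quotient (isoSetoid F m))

/-- The group `G = U(p^n - 1) / ⟨p⟩`. -/
abbrev G (p n : ℕ) : Type :=
  (ZMod (p ^ n - 1))ˣ ⧸
    Subgroup.closure {u : (ZMod (p ^ n - 1))ˣ | (u : ZMod (p ^ n - 1)) = (p : ZMod (p ^ n - 1))}

/-- The smallest integer in `{1, …, p^n - 1}` that represents the class `g`. -/
noncomputable def rep {p n : ℕ} (g : G p n) : ℕ :=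
  sInf {q : ℕ | 1 ≤ q ∧ q ≤ p ^ n - 1 ∧
    ∃ u : (ZMod (p ^ n - 1))ˣ, (u : ZMod (p ^ n - 1)) = (q : ZMod (p ^ n - 1)) ∧ (u : G p n) = g}

/-- Suitable sequences: sequences in `G`, non-decreasing when each element of `G` is identified
with its smallest representative. -/
def Suitable {p n m : ℕ} (s : Fin m → G p n) : Prop :=
  Monotone fun i => rep (s i)

/-- The set `A = {s_α | α ∈ F}` of endomorphisms of `F^m` determined by a sequence in `G`, where
`s_α : (x₁, …, x_m) ↦ (x₁ α^{q₁}, …, x_m α^{q_m})`. -/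
def seqScalars (F : Type*) [Field F] {p n m : ℕ} (s : Fin m → G p n) :
    Set (AddMonoid.End (Fin m → F)) :=
  Set.range fun α : F => diagEnd fun i => α ^ rep (s i)

/-- The relation `∼`: the near-vector spaces determined by the two sequences are isomorphic. -/
def SeqRel (F : Type*) [Field F] {p n m : ℕ} (s t : Fin m → G p n) : Prop :=
  ∃ A B : NearVectorSpace (Fin m → F),
    A.scalars = seqScalars F s ∧ B.scalars = seqScalars F t ∧ A.Iso B

/-- The equivalence class `[(S)]` among the suitable sequences with `1` in the first position. -/
def seqClass (F : Type*) [Field F] {p n m : ℕ} [NeZero m] (s : Fin m → G p n) :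
    Set (Fin m → G p n) :=
  {t | Suitable t ∧ t 0 = 1 ∧ SeqRel F s t}

/-- `St(1, m, N)`: the suitable sequences of length `m` with `1` in the first position and exactly
`N` distinct entries. -/
def StOne (p n m N : ℕ) [NeZero m] : Set (Fin m → G p n) :=
  {s | Suitable s ∧ s 0 = 1 ∧ (Set.range s).ncard = N}

/-- `T(N)`: the number of classes of `∼` on `St(1, m, N)`. -/
noncomputable def T (F : Type*) [Field F] (p n m N : ℕ) [NeZero m] : ℕ :=
  (seqClass F '' StOne p n m N).ncard

/-- `St(H, m, N)`: the suitable sequences of length `m` with `N` distinct entries whose set of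
entries contains `H` and is a union of cosets of `H`, where entries from the same coset have the
same number of occurrences. -/
def St {p n : ℕ} (H : Subgroup (G p n)) (m N : ℕ) : Set (Fin m → G p n) :=
  {s | Suitable s ∧ (Set.range s).ncard = N ∧ (H : Set (G p n)) ⊆ Set.range s ∧
    (∃ C : Set (G p n ⧸ H), Set.range s = (fun g : G p n => (g : G p n ⧸ H)) ⁻¹' C) ∧
    ∀ a ∈ Set.range s, ∀ b ∈ Set.range s, (a : G p n ⧸ H) = (b : G p n ⧸ H) →
      {i | s i = a}.ncard = {i | s i = b}.ncard}

/-- `S̄(H)`: the members of `St(H, m, N)` whose class has exactly `N / |H|` elements. -/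
def SBar (F : Type*) [Field F] {p n : ℕ} (H : Subgroup (G p n)) (m N : ℕ) [NeZero m] :
    Set (Fin m → G p n) :=
  {s | s ∈ St H m N ∧ (seqClass F s).ncard = N / Nat.card H}

/-- `t(N, d)` for a group of order `g`, used for common divisors `d` of `g`, `m`, `N`. -/
def t (g m N d : ℕ) : ℕ :=
  Nat.choose (g / d - 1) (N / d - 1) * Nat.choose (m / d - 1) (N / d - 1)

end NearVec

/-! Every automorphism of the semigroup `(F, ·)` is a power map `α ↦ α ^ k` with `k ≥ 1` prime to `p
^ n - 1`, so a space `F^m` is given by `m` exponents. Permuting coordinates and applying powers of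
Frobenius coordinatewise are additive bijections, so only the multiset of classes of the exponents
in `G` matters; reparametrising `Fˣ` translates that multiset. Nothing else is lost
(`iso_iff_expClass`): an isomorphism conjugates, additively, the scalar of a generator `ζ` into a
diagonal map. Applying to both an integer lift of the minimal polynomial of `ζ ^ q` gives kernels of
equal size `|F| ^ c`, where `c` counts the coordinates whose exponent has the class of `q`.

It remains to count multiplicity functions on a finite abelian group up to translation. A sorted
sequence is determined by its multiplicities, and `1` comes first as soon as it occurs. The
normalized translates of `s` arise by moving one of its `N` entries to `1`, and two entries give the
same result when they differ by the stabilizer; so the class of `s` has `N / |stab s|` elements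
(`ncard_translates_mul_card_stab`). Summing reciprocals of class sizes gives `T(N) = (1/N) ∑ |stab
s| = t_N/N + (1/N) ∑ (|stab s| - 1)`. The set `St(H, m, N)` is the condition `H ≤ stab s`, and
`S̄(H)` is `stab s = H`. Functions invariant under `H` live on the quotient by `H`, which yields
`t(N, |H|)` (`ncard_periodic`); sorting them by their exact stabilizer yields the recursion. -/

namespace NearVec

open Polynomial

/-- `diagEnd` as a ring homomorphism. -/
def diagHom (F : Type*) [Field F] (m : ℕ) : (Fin m → F) →+* AddMonoid.End (Fin m → F) where
  toFun := diagEnd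
  map_one' := by ext x i; simp
  map_mul' c d := by ext x i; simp [mul_comm, mul_left_comm]
  map_zero' := by
    refine DFunLike.ext _ _ fun x => funext fun i => ?_
    simp
  map_add' c d := by
    refine DFunLike.ext _ _ fun x => funext fun i => ?_
    exact mul_add _ _ _

theorem diagEnd_injective {F : Type*} [Field F] {m : ℕ} :
    Function.Injective (diagEnd : (Fin m → F) → AddMonoid.End (Fin m → F)) := by
  intro c d h
  funext i
  have := congrFun (DFunLike.congr_fun h 1) i
  simpa using this

/-! ### Scalars, isomorphisms as semilinear maps, and kernels of diagonal endomorphisms -/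

section Structure

variable {F : Type*} [Field F] {m : ℕ}

/-- The scalar `s_α` attached to multiplicative automorphisms `ψ₁, …, ψ_m`, as a homomorphism
in `α`. -/
def scalarHom (ψ : Fin m → (F ≃* F)) : F →* AddMonoid.End (Fin m → F) where
  toFun α := diagEnd fun i => ψ i α
  map_one' := by
    simp only [map_one]
    exact (diagHom F m).map_one
  map_mul' α β := by
    simp only [map_mul]
    exact (diagHom F m).map_mul (fun i => ψ i α) (fun i => ψ i β)

@[simp]
theorem scalarHom_apply (ψ : Fin m → (F ≃* F)) (α : F) (x : Fin m → F) (i : Fin m) :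
    scalarHom ψ α x i = x i * ψ i α := rfl

theorem scalarHom_injective [NeZero m] (ψ : Fin m → (F ≃* F)) :
    Function.Injective (scalarHom ψ) := by
  intro α β h
  exact (ψ 0).injective (congrFun (diagEnd_injective h) 0)

theorem scalarHom_zero (ψ : Fin m → (F ≃* F)) :
    scalarHom ψ 0 = (0 : (Fin m → F) →+ (Fin m → F)) := by
  refine DFunLike.ext _ _ fun x => funext fun i => ?_
  rw [scalarHom_apply, map_zero, mul_zero]
  rfl

/-- The image of `-1` squares to `1`; if it is `1`, injectivity forces `-1 = 1`, so characteristic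
two needs no separate treatment. -/
theorem mulEquiv_neg_one (ψ : F ≃* F) : ψ (-1) = -1 := by
  have h : ψ (-1) * ψ (-1) = 1 := by rw [← map_mul]; simp
  rcases mul_self_eq_one_iff.1 h with h1 | h1
  · have : (-1 : F) = 1 := ψ.injective (by rw [h1, map_one])
    rw [h1, this]
  · exact h1

/-- The near-vector space `F^m` determined by multiplicative automorphisms `ψ₁, …, ψ_m`. -/
def ofAut [NeZero m] (ψ : Fin m → (F ≃* F)) : NearVectorSpace (Fin m → F) where
  scalars := Set.range (scalarHom ψ)
  zero_mem := ⟨0, scalarHom_zero ψ⟩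
  id_mem := ⟨1, map_one _⟩
  neg_id_mem := ⟨_, ⟨-1, rfl⟩, fun x => funext fun i => by simp [mulEquiv_neg_one]⟩
  units := (Units.map (scalarHom ψ)).range
  coe_units f := by
    constructor
    · rintro ⟨_, ⟨α, rfl⟩, rfl⟩
      refine ⟨⟨α, rfl⟩, fun h => α.ne_zero ?_⟩
      exact scalarHom_injective ψ (h.trans (scalarHom_zero ψ).symm)
    · rintro ⟨⟨α, rfl⟩, h⟩
      have hα : α ≠ 0 := by
        rintro rfl
        exact h (scalarHom_zero ψ)
      exact ⟨_, ⟨Units.mk0 α hα, rfl⟩, rfl⟩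
  fixedPointFree := by
    rintro x _ ⟨α, rfl⟩ _ ⟨β, rfl⟩ h
    by_cases hx : x = 0
    · exact Or.inl hx
    · obtain ⟨i, hi⟩ := Function.ne_iff.1 hx
      have := congrFun h i
      simp only [scalarHom_apply] at this
      exact Or.inr (congrArg _ ((ψ i).injective (mul_left_cancel₀ hi this)))
  closure_quasiKernel := by
    rw [eq_top_iff]
    rintro x -
    -- Vectors supported on one coordinate `i` lie in the quasi-kernel: only `ψ i` acts on them, and
    -- it is surjective.
    rw [← Finset.univ_sum_single x]
    refine sum_mem fun i _ => AddSubgroup.subset_closure ?_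
    rintro _ ⟨α, rfl⟩ _ ⟨β, rfl⟩
    refine ⟨_, ⟨(ψ i).symm (ψ i α + ψ i β), rfl⟩, funext fun j => ?_⟩
    rcases eq_or_ne j i with rfl | hj
    · simp [mul_add]
    · simp [Pi.single_eq_of_ne hj]

theorem units_eq_range [NeZero m] {A : NearVectorSpace (Fin m → F)} {ψ : Fin m → (F ≃* F)}
    (hA : A.scalars = Set.range (scalarHom ψ)) : A.units = (Units.map (scalarHom ψ)).range := by
  ext u
  have h1 : u ∈ A.units ↔ (u : AddMonoid.End (Fin m → F)) ∈ A.scalars ∧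
      (u : AddMonoid.End (Fin m → F)) ≠ (0 : (Fin m → F) →+ (Fin m → F)) := by
    rw [← A.coe_units]
    exact ⟨fun h => ⟨u, h, rfl⟩, fun ⟨v, hv, h⟩ => Units.ext h ▸ hv⟩
  have h2 : u ∈ (ofAut ψ).units ↔ (u : AddMonoid.End (Fin m → F)) ∈ (ofAut ψ).scalars ∧
      (u : AddMonoid.End (Fin m → F)) ≠ (0 : (Fin m → F) →+ (Fin m → F)) := by
    rw [← (ofAut ψ).coe_units]
    exact ⟨fun h => ⟨u, h, rfl⟩, fun ⟨v, hv, h⟩ => Units.ext h ▸ hv⟩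
  rw [h1, hA]
  exact h2.symm

/-- The nonzero scalars form a copy of the group of units of `F`. -/
noncomputable def unitsEquiv [NeZero m] {A : NearVectorSpace (Fin m → F)} {ψ : Fin m → (F ≃* F)}
    (hA : A.scalars = Set.range (scalarHom ψ)) : Fˣ ≃* A.units :=
  (MonoidHom.ofInjective (f := Units.map (scalarHom ψ))
    (Units.map_injective (scalarHom_injective ψ))).trans
    (MulEquiv.subgroupCongr (units_eq_range hA).symm)

theorem coe_unitsEquiv [NeZero m] {A : NearVectorSpace (Fin m → F)} {ψ : Fin m → (F ≃* F)}
    (hA : A.scalars = Set.range (scalarHom ψ)) (α : Fˣ) :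
    ((unitsEquiv hA α : (AddMonoid.End (Fin m → F))ˣ) : AddMonoid.End (Fin m → F)) =
      scalarHom ψ α := rfl

/-- Both groups of nonzero scalars are copies of `Fˣ`, so `η` transports to an automorphism `χ` of
`Fˣ`. -/
theorem iso_iff_exists_semilinear [NeZero m] {A B : NearVectorSpace (Fin m → F)}
    {ψ φ : Fin m → (F ≃* F)} (hA : A.scalars = Set.range (scalarHom ψ))
    (hB : B.scalars = Set.range (scalarHom φ)) :
    A.Iso B ↔ ∃ (θ : (Fin m → F) ≃+ (Fin m → F)) (χ : Fˣ ≃* Fˣ), ∀ (x : Fin m → F) (α : Fˣ),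
      θ (scalarHom ψ α x) = scalarHom φ (χ α) (θ x) := by
  constructor
  · rintro ⟨θ, η, h⟩
    refine ⟨θ, ((unitsEquiv hA).trans η).trans (unitsEquiv hB).symm, fun x α => ?_⟩
    have := h x (unitsEquiv hA α)
    rw [coe_unitsEquiv] at this
    rw [this, ← coe_unitsEquiv hB]
    simp
  · rintro ⟨θ, χ, h⟩
    refine ⟨θ, ((unitsEquiv hA).symm.trans χ).trans (unitsEquiv hB), fun x a => ?_⟩
    have := h x ((unitsEquiv hA).symm a)
    rw [← coe_unitsEquiv hA, ← coe_unitsEquiv hB] at this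
    simpa using this

/-- Since `θ` is only additive, integer coefficients are the ones guaranteed to commute with it;
this is why minimal polynomials are lifted to `ℤ[X]` below. -/
theorem map_aeval_apply_of_semiconj {V W : Type*} [AddCommGroup V] [AddCommGroup W] (θ : V →+ W)
    {L : AddMonoid.End V} {M : AddMonoid.End W} (h : ∀ x, θ (L x) = M (θ x)) (f : ℤ[X]) (x : V) :
    θ (aeval L f x) = aeval M f (θ x) := by
  induction f using Polynomial.induction_on' generalizing x with
  | add f g hf hg =>
    rw [map_add, map_add]
    exact (map_add θ _ _).trans (congrArg₂ (· + ·) (hf x) (hg x))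
  | monomial k a =>
    have hk : ∀ k : ℕ, ∀ x, θ ((L ^ k) x) = (M ^ k) (θ x) := by
      intro k
      induction k with
      | zero => exact fun x => rfl
      | succ k ih =>
        intro x
        rw [pow_succ, pow_succ, AddMonoid.End.coe_mul, AddMonoid.End.coe_mul,
          Function.comp_apply, Function.comp_apply, ih, h]
    rw [aeval_monomial, aeval_monomial, AddMonoid.End.coe_mul, AddMonoid.End.coe_mul,
      Function.comp_apply, Function.comp_apply, ← hk]
    simp

theorem aeval_diagEnd (c : Fin m → F) (f : ℤ[X]) :
    aeval (diagEnd c) f = diagEnd fun i => aeval (c i) f := by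
  have h1 := aeval_algHom_apply (diagHom F m).toIntAlgHom c f
  have h2 : aeval c f = fun i => aeval (c i) f := by
    funext i
    exact (aeval_algHom_apply (Pi.evalRingHom (fun _ : Fin m => F) i).toIntAlgHom c f).symm
  rw [h2] at h1
  exact h1

theorem natCard_ker_diagEnd [Finite F] (c : Fin m → F) :
    Nat.card {x : Fin m → F // diagEnd c x = 0} = Nat.card F ^ {i | c i = 0}.ncard := by
  classical
  have e : {x : Fin m → F // diagEnd c x = 0} ≃ ({i // c i = 0} → F) :=
    { toFun := fun x i => x.1 i
      invFun := fun y => ⟨fun i => if h : c i = 0 then y ⟨i, h⟩ else 0, by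
        funext i
        by_cases h : c i = 0 <;> simp [h]⟩
      left_inv := by
        rintro ⟨x, hx⟩
        ext i
        by_cases h : c i = 0
        · simp [h]
        · have := congrFun hx i
          simp [h] at this
          simp [h, this]
      right_inv := by
        intro y
        ext ⟨i, hi⟩
        simp [hi] }
  rw [Nat.card_congr e, Nat.card_fun]
  rfl

/-- Semiconjugate diagonal endomorphisms kill equally many coordinates under any integer
polynomial. -/
theorem ncard_aeval_eq_zero_eq [Finite F] {c d : Fin m → F} (θ : (Fin m → F) ≃+ (Fin m → F))
    (h : ∀ x, θ (diagEnd c x) = diagEnd d (θ x)) (f : ℤ[X]) :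
    {i | aeval (c i) f = 0}.ncard = {i | aeval (d i) f = 0}.ncard := by
  have h1 := natCard_ker_diagEnd fun i => aeval (c i) f
  have h2 := natCard_ker_diagEnd fun i => aeval (d i) f
  have h3 : Nat.card {x : Fin m → F // diagEnd (fun i => aeval (c i) f) x = 0} =
      Nat.card {x : Fin m → F // diagEnd (fun i => aeval (d i) f) x = 0} := by
    refine Nat.card_congr (θ.toEquiv.subtypeEquiv fun x => ?_)
    have := map_aeval_apply_of_semiconj θ.toAddMonoidHom h f x
    rw [aeval_diagEnd, aeval_diagEnd] at this
    change _ ↔ diagEnd _ (θ x) = 0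
    change θ _ = _ at this
    rw [← EmbeddingLike.map_eq_zero_iff (f := θ), this]
    rfl
  rw [h1, h2] at h3
  exact Nat.pow_right_injective Finite.one_lt_card h3

end Structure

theorem exists_perm_of_ncard_fiber {ι γ : Type*} [Finite ι] {f g : ι → γ}
    (h : ∀ c, {i | f i = c}.ncard = {i | g i = c}.ncard) :
    ∃ σ : Equiv.Perm ι, ∀ i, g (σ i) = f i := by
  have e : ∀ c, Nonempty ({i // f i = c} ≃ {i // g i = c}) := fun c =>
    (Finite.card_eq).1 (h c)
  exact ⟨Equiv.ofFiberEquiv fun c => (e c).some, fun i => Equiv.ofFiberEquiv_map _ i⟩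

/-! ### Exponents and their classes in `G` -/

section Exponents

variable {p n : ℕ}

theorem coprime_pow_sub_one (h : 1 < p ^ n) : p.Coprime (p ^ n - 1) := by
  have hn : n ≠ 0 := by rintro rfl; simp at h
  have h1 : (p ^ n).Coprime (p ^ n - 1) := by
    have : p ^ n = (p ^ n - 1) + 1 := by omega
    rw [this]
    simp
  exact h1.coprime_dvd_left (dvd_pow_self p hn)

/-- The class in `G` of an integer prime to `p ^ n - 1` (and `1` for the other integers). -/
noncomputable def expClass (p n k : ℕ) : G p n :=
  open Classical in
  if h : k.Coprime (p ^ n - 1) then (ZMod.unitOfCoprime k h : G p n) else 1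

theorem expClass_of_coprime {k : ℕ} (h : k.Coprime (p ^ n - 1)) :
    expClass p n k = (ZMod.unitOfCoprime k h : G p n) := dif_pos h

theorem expClass_mul {k l : ℕ} (hk : k.Coprime (p ^ n - 1)) (hl : l.Coprime (p ^ n - 1)) :
    expClass p n (k * l) = expClass p n k * expClass p n l := by
  rw [expClass_of_coprime hk, expClass_of_coprime hl, expClass_of_coprime (hk.mul_left hl),
    ← QuotientGroup.mk_mul]
  congr 1
  ext
  simp

theorem finite_G (h : 1 < p ^ n) : Finite (G p n) := by
  have : NeZero (p ^ n - 1) := ⟨by omega⟩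
  infer_instance

/-- `p` is a unit modulo `p ^ n - 1`, and in a finite group the subgroup it generates consists of
its natural powers. Equality in `G` thus means equality of exponents up to Frobenius. -/
theorem expClass_eq_iff (h : 1 < p ^ n) {k l : ℕ} (hk : k.Coprime (p ^ n - 1))
    (hl : l.Coprime (p ^ n - 1)) :
    expClass p n k = expClass p n l ↔ ∃ j, k ≡ l * p ^ j [MOD p ^ n - 1] := by
  have : NeZero (p ^ n - 1) := ⟨by omega⟩
  have hS : {u : (ZMod (p ^ n - 1))ˣ | (u : ZMod (p ^ n - 1)) = (p : ZMod (p ^ n - 1))} =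
      {ZMod.unitOfCoprime p (coprime_pow_sub_one h)} := by
    ext u
    simp [Units.ext_iff]
  rw [expClass_of_coprime hk, expClass_of_coprime hl, eq_comm, QuotientGroup.eq, hS,
    ← Subgroup.zpowers_eq_closure, ← mem_powers_iff_mem_zpowers, Submonoid.mem_powers_iff]
  refine exists_congr fun j => ?_
  rw [eq_inv_mul_iff_mul_eq, Units.ext_iff, ← ZMod.natCast_eq_natCast_iff, eq_comm]
  simp

theorem exists_expClass_eq (h : 1 < p ^ n) (g : G p n) :
    ∃ k, 1 ≤ k ∧ k ≤ p ^ n - 1 ∧ k.Coprime (p ^ n - 1) ∧ expClass p n k = g := by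
  have : NeZero (p ^ n - 1) := ⟨by omega⟩
  obtain ⟨u, rfl⟩ := QuotientGroup.mk_surjective g
  have key : ∀ k : ℕ, (k : ZMod (p ^ n - 1)) = u → k.Coprime (p ^ n - 1) ∧
      expClass p n k = (u : G p n) := by
    intro k hk
    have hc : k.Coprime (p ^ n - 1) := by
      rw [← ZMod.isUnit_iff_coprime, hk]
      exact u.isUnit
    refine ⟨hc, ?_⟩
    rw [expClass_of_coprime hc]
    congr 1
    ext
    simpa using hk
  by_cases h0 : (u : ZMod (p ^ n - 1)).val = 0
  -- The residue `0` is represented by `p ^ n - 1`, since representatives must be positive; it is a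
  -- unit only when `p ^ n = 2`.
  · refine ⟨p ^ n - 1, by omega, le_rfl, key _ ?_⟩
    rw [ZMod.natCast_self, (ZMod.val_eq_zero _).1 h0]
  · exact ⟨(u : ZMod (p ^ n - 1)).val, by omega, (ZMod.val_lt _).le, key _ (by simp)⟩

theorem rep_spec (h : 1 < p ^ n) (g : G p n) :
    1 ≤ rep g ∧ (rep g).Coprime (p ^ n - 1) ∧ expClass p n (rep g) = g := by
  have hne : {q : ℕ | 1 ≤ q ∧ q ≤ p ^ n - 1 ∧ ∃ u : (ZMod (p ^ n - 1))ˣ,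
      (u : ZMod (p ^ n - 1)) = (q : ZMod (p ^ n - 1)) ∧ (u : G p n) = g}.Nonempty := by
    obtain ⟨k, h1, h2, h3, h4⟩ := exists_expClass_eq h g
    exact ⟨k, h1, h2, ZMod.unitOfCoprime k h3, ZMod.coe_unitOfCoprime k h3,
      by rw [← h4, expClass_of_coprime h3]⟩
  obtain ⟨h1, -, u, hu, hg⟩ := Nat.sInf_mem hne
  have hc : (rep g).Coprime (p ^ n - 1) := by
    rw [← ZMod.isUnit_iff_coprime]
    exact hu ▸ u.isUnit
  refine ⟨h1, hc, ?_⟩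
  rw [expClass_of_coprime hc]
  refine Eq.trans (congrArg _ ?_) hg
  ext
  exact hu.symm

theorem rep_injective (h : 1 < p ^ n) : Function.Injective (rep : G p n → ℕ) := by
  intro a b hab
  rw [← (rep_spec h a).2.2, hab, (rep_spec h b).2.2]

theorem rep_one (h : 1 < p ^ n) : rep (1 : G p n) = 1 := by
  refine le_antisymm (Nat.sInf_le ⟨le_rfl, by omega, 1, by simp, rfl⟩) (rep_spec h 1).1

end Exponents

/-! ### Power automorphisms of a finite field and the isomorphism criterion -/

section FiniteField

theorem finite_of_natCard {p n : ℕ} {F : Type*} (hp : p.Prime) (hF : Nat.card F = p ^ n) :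
    Finite F :=
  Nat.finite_of_card_ne_zero (by rw [hF]; exact (pow_pos hp.pos n).ne')

variable {p n : ℕ} {F : Type*} [Field F]

theorem one_lt_of_natCard (hp : p.Prime) (hF : Nat.card F = p ^ n) : 1 < p ^ n := by
  have := finite_of_natCard hp hF
  rw [← hF]
  exact Finite.one_lt_card

theorem charP_of_natCard (hp : p.Prime) (hF : Nat.card F = p ^ n) : CharP F p := by
  have := finite_of_natCard hp hF
  have := Fintype.ofFinite F
  have : Fact p.Prime := ⟨hp⟩
  exact charP_of_card_eq_prime_pow (f := n) (by rw [← hF, Nat.card_eq_fintype_card])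

theorem natCard_units_of_natCard (hF : Nat.card F = p ^ n) : Nat.card Fˣ = p ^ n - 1 := by
  rw [Nat.card_units, hF]

/-- The polynomial whose roots are the conjugates of `x` over the prime field, with coefficients
lifted to the integers. -/
theorem exists_intPoly_roots (hp : p.Prime) (hF : Nat.card F = p ^ n) (x : F) :
    ∃ f : ℤ[X], ∀ y : F, aeval y f = 0 ↔ ∃ j : ℕ, y = x ^ p ^ j := by
  have := finite_of_natCard hp hF
  have := charP_of_natCard hp hF
  have : Fact p.Prime := ⟨hp⟩
  let _ : Algebra (ZMod p) F := ZMod.algebra F p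
  obtain ⟨f, hf⟩ := Polynomial.map_surjective (algebraMap ℤ (ZMod p))
    (ZMod.ringHom_surjective _) (minpoly (ZMod p) x)
  refine ⟨f, fun y => ?_⟩
  have hpow : ∀ (j : ℕ) (z : F),
      (FiniteField.frobeniusAlgEquivOfAlgebraic (ZMod p) F ^ j) z = z ^ p ^ j := by
    intro j z
    induction j generalizing z with
    | zero => simp
    | succ j ih =>
      rw [pow_succ, AlgEquiv.mul_apply, ih, FiniteField.coe_frobeniusAlgEquivOfAlgebraic,
        ZMod.card, ← pow_mul, pow_succ' p j]
  have hint : IsIntegral (ZMod p) x := Algebra.IsIntegral.isIntegral x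
  -- The roots of the minimal polynomial in `F` are the Galois conjugates of `x`, and the Galois
  -- group over the prime field consists of powers of Frobenius.
  rw [← aeval_map_algebraMap (ZMod p) y f, hf, ← isConjRoot_iff_aeval_eq_zero hint,
    show IsConjRoot (ZMod p) x y ↔ IsConjRoot (ZMod p) y x from ⟨fun h => h.symm, fun h => h.symm⟩,
    isConjRoot_iff_exists_algEquiv]
  constructor
  · rintro ⟨σ, hσ⟩
    obtain ⟨j, rfl⟩ := (FiniteField.bijective_frobeniusAlgEquivOfAlgebraic_pow (ZMod p) F).2 σ
    exact ⟨j, by rw [← hσ]; exact hpow j x⟩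
  · rintro ⟨j, rfl⟩
    exact ⟨_, hpow j x⟩

theorem exists_generator (hp : p.Prime) (hF : Nat.card F = p ^ n) :
    ∃ ζ : Fˣ, (∀ α, ∃ j : ℕ, ζ ^ j = α) ∧ orderOf ζ = p ^ n - 1 := by
  have := finite_of_natCard hp hF
  obtain ⟨ζ, hζ⟩ := IsCyclic.exists_monoid_generator (α := Fˣ)
  refine ⟨ζ, fun α => Submonoid.mem_powers_iff _ _ |>.1 (hζ α), ?_⟩
  rw [← natCard_units_of_natCard hF]
  exact orderOf_eq_card_of_forall_mem_zpowers fun α => mem_powers_iff_mem_zpowers.1 (hζ α)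

/-- `Fˣ` is cyclic, so `χ` is the power map read off from a generator; preserving the order of the
generator makes the exponent coprime to `p ^ n - 1`. -/
theorem exists_exponent (hp : p.Prime) (hF : Nat.card F = p ^ n) (χ : Fˣ ≃* Fˣ) :
    ∃ k : ℕ, 1 ≤ k ∧ k.Coprime (p ^ n - 1) ∧ ∀ α, χ α = α ^ k := by
  have := finite_of_natCard hp hF
  obtain ⟨ζ, hζ, hord⟩ := exists_generator hp hF
  have hq := one_lt_of_natCard hp hF
  obtain ⟨k, hk⟩ := hζ (χ ζ)
  -- Adding the group order makes the exponent positive, so that the power map on `F` also sends `0`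
  -- to `0`.
  refine ⟨k + (p ^ n - 1), by omega, ?_, fun α => ?_⟩
  · have h1 : orderOf (ζ ^ k) = orderOf ζ := by rw [hk, MulEquiv.orderOf_eq]
    rw [orderOf_pow, hord] at h1
    have h2 := (Nat.div_eq_self.1 h1).resolve_left (by omega)
    simpa [Nat.coprime_comm] using h2
  · obtain ⟨j, rfl⟩ := hζ α
    rw [map_pow, ← hk, pow_add, ← hord, ← pow_mul ζ j (orderOf ζ), mul_comm j (orderOf ζ),
      pow_mul ζ (orderOf ζ), pow_orderOf_eq_one, one_pow, mul_one, ← pow_mul, ← pow_mul, mul_comm]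

theorem exists_powEquiv_units (hF : Nat.card F = p ^ n) {k : ℕ} (hk : k.Coprime (p ^ n - 1)) :
    ∃ χ : Fˣ ≃* Fˣ, ∀ α, χ α = α ^ k := by
  rw [← natCard_units_of_natCard hF] at hk
  exact ⟨MulEquiv.ofBijective (powMonoidHom k) (powCoprime hk.symm).bijective, fun α => rfl⟩

theorem exists_powEquiv (hp : p.Prime) (hF : Nat.card F = p ^ n) {k : ℕ} (h1 : 1 ≤ k)
    (hk : k.Coprime (p ^ n - 1)) : ∃ ψ : F ≃* F, ∀ α, ψ α = α ^ k := by
  have := finite_of_natCard hp hF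
  obtain ⟨χ, hχ⟩ := exists_powEquiv_units hF hk
  refine ⟨MulEquiv.ofBijective (powMonoidHom k) (Finite.injective_iff_bijective.1 ?_),
    fun α => rfl⟩
  intro α β h
  change α ^ k = β ^ k at h
  have hk0 : k ≠ 0 := by omega
  by_cases hα : α = 0
  · subst hα
    rw [zero_pow hk0, eq_comm, pow_eq_zero_iff hk0] at h
    exact h.symm
  · have hβ : β ≠ 0 := by
      rintro rfl
      rw [zero_pow hk0, pow_eq_zero_iff hk0] at h
      exact hα h
    have := χ.injective (a₁ := Units.mk0 α hα) (a₂ := Units.mk0 β hβ)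
      (by rw [hχ, hχ]; ext; simpa using h)
    simpa using congrArg Units.val this

theorem exists_exponent_of_mulEquiv (hp : p.Prime) (hF : Nat.card F = p ^ n) (ψ : F ≃* F) :
    ∃ k : ℕ, 1 ≤ k ∧ k.Coprime (p ^ n - 1) ∧ ∀ α, ψ α = α ^ k := by
  obtain ⟨k, h1, h2, h3⟩ := exists_exponent hp hF (Units.mapEquiv ψ)
  refine ⟨k, h1, h2, fun α => ?_⟩
  by_cases hα : α = 0
  · subst hα
    rw [map_zero, zero_pow (by omega)]
  · simpa using congrArg Units.val (h3 (Units.mk0 α hα))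

variable {m : ℕ}

/-- The scalars `(x₁, …, x_m) ↦ (x₁ α^{k₁}, …, x_m α^{k_m})`. -/
def expScalars (F : Type*) [Field F] (k : Fin m → ℕ) : Set (AddMonoid.End (Fin m → F)) :=
  Set.range fun α : F => diagEnd fun i => α ^ k i

/-- Positive exponents prime to `p ^ n - 1`. -/
def IsExponents (p n : ℕ) (k : Fin m → ℕ) : Prop :=
  ∀ i, 1 ≤ k i ∧ (k i).Coprime (p ^ n - 1)

theorem exists_scalarHom_eq (hp : p.Prime) (hF : Nat.card F = p ^ n) {k : Fin m → ℕ}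
    (hk : IsExponents p n k) : ∃ ψ : Fin m → (F ≃* F), (∀ i α, ψ i α = α ^ k i) ∧
      expScalars F k = Set.range (scalarHom ψ) := by
  choose ψ hψ using fun i => exists_powEquiv hp hF (hk i).1 (hk i).2
  refine ⟨ψ, hψ, congrArg Set.range (funext fun α => ?_)⟩
  exact congrArg diagEnd (funext fun i => (hψ i α).symm)

/-- Necessity compares kernels of an integer polynomial in the scalar of a generator; sufficiency
builds `θ` from a permutation of coordinates and powers of Frobenius. -/
theorem iso_iff_expClass [NeZero m] (hp : p.Prime) (hF : Nat.card F = p ^ n)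
    {A B : NearVectorSpace (Fin m → F)} {k l : Fin m → ℕ} (hk : IsExponents p n k)
    (hl : IsExponents p n l) (hA : A.scalars = expScalars F k) (hB : B.scalars = expScalars F l) :
    A.Iso B ↔ ∃ a : G p n, ∀ g,
      {i | expClass p n (k i) = g}.ncard = {i | expClass p n (l i) = a * g}.ncard := by
  have := finite_of_natCard hp hF
  have := charP_of_natCard hp hF
  have : Fact p.Prime := ⟨hp⟩
  have hq := one_lt_of_natCard hp hF
  obtain ⟨ψ, hψ, hψ'⟩ := exists_scalarHom_eq hp hF hk
  obtain ⟨φ, hφ, hφ'⟩ := exists_scalarHom_eq hp hF hl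
  rw [iso_iff_exists_semilinear (hA.trans hψ') (hB.trans hφ')]
  constructor
  · rintro ⟨θ, χ, h⟩
    obtain ⟨a, ha1, ha2, ha3⟩ := exists_exponent hp hF χ
    obtain ⟨ζ, -, hord⟩ := exists_generator hp hF
    refine ⟨(expClass p n a)⁻¹, fun g => ?_⟩
    obtain ⟨q, hq1, -, hq2, rfl⟩ := exists_expClass_eq hq g
    obtain ⟨f, hf⟩ := exists_intPoly_roots hp hF ((ζ : F) ^ q)
    -- As `ζ` has order `p ^ n - 1`, conjugacy of `ζ ^ r` and `ζ ^ q` is the congruence `r ≡ q * p ^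
    -- j`, that is, equality in `G`.
    have hroot : ∀ r : ℕ, r.Coprime (p ^ n - 1) →
        (aeval ((ζ : F) ^ r) f = 0 ↔ expClass p n r = expClass p n q) := by
      intro r hr
      rw [hf, expClass_eq_iff hq hr hq2]
      refine exists_congr fun j => ?_
      rw [← hord, ← pow_eq_pow_iff_modEq, ← pow_mul, Units.ext_iff]
      simp
    have key := ncard_aeval_eq_zero_eq θ (c := fun i => (ζ : F) ^ k i)
      (d := fun i => (ζ : F) ^ (a * l i)) (fun x => ?_) f
    · simp only [hroot _ (hk _).2, hroot _ (ha2.mul_left (hl _).2),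
        expClass_mul ha2 (hl _).2] at key
      rw [key]
      simp only [eq_inv_mul_iff_mul_eq]
    · have h1 := h x ζ
      have e1 : scalarHom ψ (ζ : F) = diagEnd fun i => (ζ : F) ^ k i :=
        congrArg diagEnd (funext fun i => hψ i _)
      have e2 : scalarHom φ (χ ζ : Fˣ) = diagEnd fun i => (ζ : F) ^ (a * l i) :=
        congrArg diagEnd (funext fun i => by rw [hφ, ha3]; simp [pow_mul])
      rw [← e1, h1, e2]
  · rintro ⟨b, hb⟩
    obtain ⟨σ, hσ⟩ := exists_perm_of_ncard_fiber (f := fun i => b * expClass p n (k i))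
      (g := fun i => expClass p n (l i)) fun c => by
        have := hb (b⁻¹ * c)
        rw [mul_inv_cancel_left] at this
        rw [← this]
        simp only [eq_inv_mul_iff_mul_eq]
    -- `χ` is to be `α ↦ α ^ a`; with `a` in the class of `b⁻¹`, the exponents `a * l (σ i)` and `k
    -- i` differ by a power of `p` for each `i`.
    obtain ⟨a, ha1, -, ha2, ha3⟩ := exists_expClass_eq hq b⁻¹
    have hj : ∀ i, ∃ j, a * l (σ i) ≡ k i * p ^ j [MOD p ^ n - 1] := by
      intro i
      rw [← expClass_eq_iff hq (ha2.mul_left (hl _).2) (hk i).2, expClass_mul ha2 (hl _).2, hσ,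
        ha3, inv_mul_cancel_left]
    choose j hj using hj
    obtain ⟨χ, hχ⟩ := exists_powEquiv_units hF ha2
    -- Coordinate `i` is raised to the power `p ^ j i` and moved to position `σ i`.
    let θ : (Fin m → F) ≃+ (Fin m → F) :=
      (AddEquiv.piCongrRight fun i => (iterateFrobeniusEquiv F p (j i)).toAddEquiv).trans
        (AddEquiv.arrowCongr σ (AddEquiv.refl F))
    have hθ : ∀ x i, θ x (σ i) = x i ^ p ^ j i := by
      intro x i
      simp [θ, AddEquiv.arrowCongr, iterateFrobenius_def]
    refine ⟨θ, χ, fun x α => funext fun i' => ?_⟩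
    obtain ⟨i, rfl⟩ := σ.surjective i'
    rw [hθ, scalarHom_apply, scalarHom_apply, hθ, mul_pow, hψ, hφ, hχ, Units.val_pow_eq_pow_val,
      ← pow_mul, ← pow_mul]
    congr 1
    rw [← Units.val_pow_eq_pow_val, ← Units.val_pow_eq_pow_val, ← Units.ext_iff, eq_comm,
      pow_eq_pow_iff_modEq]
    refine (hj i).of_dvd ?_
    rw [← natCard_units_of_natCard hF]
    exact orderOf_dvd_natCard α

end FiniteField

/-! ### Multiplicity functions and their translation stabilizers -/

section Multiplicity

variable {Γ : Type*} {m : ℕ}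

/-- The number of occurrences of `g` in the sequence `s`. -/
noncomputable def mult (s : Fin m → Γ) (g : Γ) : ℕ := {i | s i = g}.ncard

theorem mult_ne_zero_iff {s : Fin m → Γ} {g : Γ} : mult s g ≠ 0 ↔ g ∈ Set.range s := by
  rw [mult, ← Nat.pos_iff_ne_zero, Set.ncard_pos]
  rfl

theorem range_eq_support_mult (s : Fin m → Γ) : Set.range s = Function.support (mult s) :=
  Set.ext fun _ => mult_ne_zero_iff.symm

theorem mult_comp_perm (s : Fin m → Γ) (σ : Equiv.Perm (Fin m)) : mult (s ∘ σ) = mult s := by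
  funext g
  exact Nat.card_congr (σ.subtypeEquiv fun _ => Iff.rfl)

theorem sum_mult [Fintype Γ] (s : Fin m → Γ) : ∑ g, mult s g = m := by
  classical
  have h := Finset.card_eq_sum_card_fiberwise (f := s) (s := Finset.univ) (t := Finset.univ)
    (fun _ _ => by simp)
  rw [Finset.card_univ, Fintype.card_fin] at h
  refine Eq.trans (Finset.sum_congr rfl fun g _ => ?_) h.symm
  rw [mult, ← Set.ncard_coe_finset]
  simp

theorem exists_mult_eq [Fintype Γ] {μ : Γ → ℕ} (h : ∑ g, μ g = m) :
    ∃ s : Fin m → Γ, mult s = μ := by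
  have e : Fin m ≃ Σ g, Fin (μ g) := Fintype.equivOfCardEq (by simp [h])
  refine ⟨fun i => (e i).1, funext fun g => ?_⟩
  have e2 : {i // (e i).1 = g} ≃ {x : Σ g, Fin (μ g) // x.1 = g} :=
    e.subtypeEquiv fun _ => Iff.rfl
  refine (Nat.card_congr (e2.trans (Equiv.sigmaSubtype g))).trans ?_
  simp

variable [CommGroup Γ]

theorem mult_mul_left (s : Fin m → Γ) (a g : Γ) :
    mult (fun i => a⁻¹ * s i) g = mult s (a * g) := by
  simp only [mult, inv_mul_eq_iff_eq_mul]

/-- The stabilizer of the multiplicity function of a sequence under translation. -/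
def stab (s : Fin m → Γ) : Subgroup Γ where
  carrier := {h | ∀ g, mult s (h * g) = mult s g}
  one_mem' g := by rw [one_mul]
  mul_mem' {a b} ha hb g := by rw [mul_assoc, ha, hb]
  inv_mem' {a} ha g := by
    have := ha (a⁻¹ * g)
    rw [mul_inv_cancel_left] at this
    exact this.symm

theorem mult_eq_of_mk_eq {s : Fin m → Γ} {H : Subgroup Γ} (hH : H ≤ stab s) {a b : Γ}
    (h : (a : Γ ⧸ H) = b) : mult s a = mult s b := by
  have := hH (QuotientGroup.eq.1 h) a
  rw [mul_comm, mul_inv_cancel_left] at this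
  exact this.symm

theorem ncard_preimage_mk [Finite Γ] (H : Subgroup Γ) (C : Set (Γ ⧸ H)) :
    ((fun g : Γ => (g : Γ ⧸ H)) ⁻¹' C).ncard = Nat.card H * C.ncard := by
  rw [← Nat.card_coe_set_eq, ← Nat.card_coe_set_eq,
    Nat.card_congr (QuotientGroup.preimageMkEquivSubgroupProdSet H C), Nat.card_prod]

theorem sum_comp_mk [Fintype Γ] (H : Subgroup Γ) [Fintype (Γ ⧸ H)] (ν : Γ ⧸ H → ℕ) :
    ∑ g : Γ, ν g = Nat.card H * ∑ c, ν c := by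
  classical
  rw [← Finset.sum_fiberwise (g := fun g : Γ => (g : Γ ⧸ H)), Finset.mul_sum]
  refine Finset.sum_congr rfl fun c _ => ?_
  rw [Finset.sum_congr rfl (g := fun _ => ν c) fun g hg => by rw [(Finset.mem_filter.1 hg).2],
    Finset.sum_const, smul_eq_mul]
  congr 1
  have h := ncard_preimage_mk H {c}
  rw [Set.ncard_singleton, mul_one] at h
  rw [← h, ← Set.ncard_coe_finset]
  congr 1
  ext
  simp

/-- The multiplicities have total `m` and are constant on cosets of `H`, each of which has `|H|`
elements. -/
theorem natCard_dvd_of_le_stab [Finite Γ] {s : Fin m → Γ} {H : Subgroup Γ} (hH : H ≤ stab s) :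
    Nat.card H ∣ m := by
  have := Fintype.ofFinite Γ
  have := Fintype.ofFinite (Γ ⧸ H)
  refine ⟨∑ c : Γ ⧸ H, mult s c.out, ?_⟩
  rw [← sum_comp_mk H]
  refine (sum_mult s).symm.trans ?_
  exact Finset.sum_congr rfl fun g _ => mult_eq_of_mk_eq hH (Quotient.out_eq' _).symm

end Multiplicity

/-! ### Binomial counts and sums over stabilizers -/

section Counting

open Finset in
theorem card_filter_mem_powersetCard {Γ : Type*} [Fintype Γ] [DecidableEq Γ] (x : Γ) {N : ℕ}
    (hN : 1 ≤ N) : ((powersetCard N (univ : Finset Γ)).filter (x ∈ ·)).card =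
      (Fintype.card Γ - 1).choose (N - 1) := by
  rw [← card_univ, ← card_erase_of_mem (mem_univ x), ← card_powersetCard]
  refine card_nbij' (fun S => S.erase x) (fun S => insert x S) ?_ ?_ ?_ ?_
  · intro S hS
    simp only [coe_filter, mem_powersetCard_univ, Set.mem_ofPred_eq] at hS
    simp [mem_powersetCard, card_erase_of_mem hS.2, hS.1, erase_subset_erase]
  · intro S hS
    simp only [mem_coe, mem_powersetCard, subset_erase] at hS
    simp [card_insert_of_notMem hS.1.2, hS.2]
    omega
  · intro S hS
    simp only [coe_filter, mem_powersetCard_univ, Set.mem_ofPred_eq] at hS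
    exact insert_erase hS.2
  · intro S hS
    simp only [mem_coe, mem_powersetCard, subset_erase] at hS
    exact erase_insert hS.1.2

open Finset in
theorem card_piAntidiag_nat {Γ : Type*} [DecidableEq Γ] (S : Finset Γ) (k : ℕ) :
    (piAntidiag S k).card = (S.card + k - 1).choose k := by
  rw [← card_finsuppAntidiag_nat_eq_choose, finsuppAntidiag, card_map, card_attach]

/-- The multiplicity functions of total mass `m` supported on `N` points, one of them `x`. -/
def massFunctions {Γ : Type*} [Fintype Γ] (x : Γ) (m N : ℕ) : Set (Γ → ℕ) :=
  {μ | ∑ g, μ g = m ∧ (Function.support μ).ncard = N ∧ μ x ≠ 0}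

-- The first binomial chooses the support `S` through `x`; the second counts the compositions of `m`
-- into `N` positive parts placed on `S`.
open Finset in
theorem ncard_massFunctions {Γ : Type*} [Fintype Γ] (x : Γ) {m N : ℕ} (hN : 1 ≤ N) (hm : N ≤ m) :
    (massFunctions x m N).ncard =
      (Nat.card Γ - 1).choose (N - 1) * (m - 1).choose (N - 1) := by
  classical
  let supp : (Γ → ℕ) → Finset Γ := fun μ => univ.filter fun g => μ g ≠ 0
  have hsupp : ∀ μ, (Function.support μ).ncard = (supp μ).card := by
    intro μ
    rw [← Set.ncard_coe_finset]
    congr 1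
    ext
    simp [supp]
  let X : Finset (Γ → ℕ) :=
    (piAntidiag univ m).filter fun μ => (supp μ).card = N ∧ μ x ≠ 0
  have hX : massFunctions x m N = X := by
    ext μ
    simp [massFunctions, X, hsupp]
  have hmaps : Set.MapsTo supp X ((powersetCard N (univ : Finset Γ)).filter (x ∈ ·) :) := by
    intro μ hμ
    have hμ' := (mem_filter.1 (mem_coe.1 hμ)).2
    refine mem_coe.2 (mem_filter.2 ⟨mem_powersetCard_univ.2 hμ'.1, ?_⟩)
    simpa [supp] using hμ'.2
  rw [hX, Set.ncard_coe_finset, card_eq_sum_card_fiberwise hmaps, Nat.card_eq_fintype_card,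
    ← card_filter_mem_powersetCard x hN, ← smul_eq_mul, ← sum_const]
  refine sum_congr rfl fun S hS => ?_
  obtain ⟨hS1, hS2⟩ := mem_filter.1 hS
  rw [mem_powersetCard_univ] at hS1
  have hcount : (piAntidiag S (m - N)).card = (m - 1).choose (N - 1) := by
    rw [card_piAntidiag_nat, hS1, show N + (m - N) - 1 = m - 1 by omega,
      ← Nat.choose_symm (by omega : N - 1 ≤ m - 1)]
    congr 1
    omega
  rw [← hcount]
  symm
  -- Taking `1` away at each point of `S` turns positive parts of sum `m` into arbitrary ones of sum
  -- `m - N`.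
  refine card_nbij' (fun μ g => μ g + if g ∈ S then 1 else 0)
    (fun μ g => μ g - if g ∈ S then 1 else 0) ?_ ?_ ?_ ?_
  · intro μ hμ
    obtain ⟨h1, h2⟩ := mem_piAntidiag.1 (mem_coe.1 hμ)
    have hs : supp (fun g => μ g + if g ∈ S then 1 else 0) = S := by
      ext g
      by_cases hg : g ∈ S
      · simp [supp, hg]
      · have : μ g = 0 := by_contra fun h => hg (h2 g h)
        simp [supp, hg, this]
    have hsum : ∑ g, μ g = m - N := by
      rw [← h1]
      exact (sum_subset (subset_univ S) fun g _ hg => by_contra fun h => hg (h2 g h)).symm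
    refine mem_coe.2 (mem_filter.2 ⟨mem_filter.2 ⟨mem_piAntidiag.2 ⟨?_, fun _ _ => mem_univ _⟩,
      by rw [hs, hS1], by simp [hS2]⟩, hs⟩)
    rw [sum_add_distrib, hsum]
    simp [hS1, hm]
  · intro μ hμ
    obtain ⟨h1, h2⟩ := mem_filter.1 (mem_coe.1 hμ)
    have h3 := (mem_piAntidiag.1 (mem_filter.1 h1).1).1
    have hmem : ∀ g, g ∈ S ↔ μ g ≠ 0 := fun g => by rw [← h2]; simp [supp]
    refine mem_coe.2 (mem_piAntidiag.2 ⟨?_, fun g hg => (hmem g).2 fun h => hg (by simp [h])⟩)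
    have h4 : ∑ g ∈ S, μ g = m := by
      rw [← h3]
      exact sum_subset (subset_univ S) fun g _ hg => by_contra fun h => hg ((hmem g).2 h)
    have h5 : ∑ g ∈ S, (μ g - if g ∈ S then 1 else 0) + ∑ g ∈ S, 1 = ∑ g ∈ S, μ g := by
      rw [← sum_add_distrib]
      refine sum_congr rfl fun g hg => ?_
      have := (hmem g).1 hg
      simp only [hg, if_true]
      omega
    rw [h4, ← card_eq_sum_ones, hS1] at h5
    exact Nat.eq_sub_of_add_eq h5
  · intro μ hμ
    funext g
    simp
  · intro μ hμ
    obtain ⟨h1, h2⟩ := mem_filter.1 (mem_coe.1 hμ)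
    have hmem : ∀ g, g ∈ S ↔ μ g ≠ 0 := fun g => by rw [← h2]; simp [supp]
    funext g
    by_cases hg : g ∈ S
    · have := (hmem g).1 hg
      simp only [hg, if_true]
      omega
    · simp [hg]

/-- The number of fibers of a partition, as a sum over the points. -/
theorem ncard_image_eq_sum {α : Type*} (X : Finset α) (cl : α → Set α)
    (h : ∀ x ∈ X, ∀ y, y ∈ cl x ↔ y ∈ X ∧ cl y = cl x) :
    ((cl '' X).ncard : ℚ) = ∑ x ∈ X, 1 / ((cl x).ncard : ℚ) := by
  classical
  rw [← Finset.coe_image, Set.ncard_coe_finset,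
    ← Finset.sum_fiberwise_of_maps_to (t := X.image cl) (g := cl)
      fun x hx => Finset.mem_image_of_mem cl hx, Finset.card_eq_sum_ones, Nat.cast_sum]
  refine Finset.sum_congr rfl fun C hC => ?_
  obtain ⟨x, hx, rfl⟩ := Finset.mem_image.1 hC
  have hC' : ((X.filter fun y => cl y = cl x : Finset α) : Set α) = cl x := by
    ext y
    rw [h x hx y]
    simp
  have hcard : (X.filter fun y => cl y = cl x).card = (cl x).ncard := by
    rw [← Set.ncard_coe_finset, hC']
  -- Each class contributes its size times the reciprocal of its size.
  rw [Finset.sum_congr rfl (g := fun _ => 1 / ((cl x).ncard : ℚ))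
    fun y hy => by rw [(Finset.mem_filter.1 hy).2], Finset.sum_const, hcard, nsmul_eq_mul]
  have hne : ((cl x).ncard : ℚ) ≠ 0 := by
    rw [← hcard, Nat.cast_ne_zero]
    exact Finset.card_ne_zero_of_mem (Finset.mem_filter.2 ⟨hx, rfl⟩)
  rw [mul_one_div_cancel hne]
  simp

-- Points are grouped by the order of their stabilizer and then by the stabilizer itself; those with
-- trivial stabilizer contribute `0`, hence the restriction to `1 < d`.
open Finset in
theorem sum_card_sub_one_eq {α Γ : Type*} [CommGroup Γ] [Finite Γ] (X : Finset α)
    (st : α → Subgroup Γ) {D : ℕ} (hD : D ≠ 0) (hst : ∀ x ∈ X, Nat.card (st x) ∣ D)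
    (cnt : Subgroup Γ → ℕ)
    (hcnt : ∀ H : Subgroup Γ, Nat.card H ∣ D → cnt H = {x | x ∈ X ∧ st x = H}.ncard) :
    ∑ d ∈ D.divisors with 1 < d, ((d : ℚ) - 1) *
        (∑ᶠ (H : Subgroup Γ) (_ : Nat.card H = d), (cnt H : ℚ)) =
      ∑ x ∈ X, ((Nat.card (st x) : ℚ) - 1) := by
  classical
  have := Fintype.ofFinite (Subgroup Γ)
  have hcnt' : ∀ H : Subgroup Γ, Nat.card H ∣ D → cnt H = (X.filter fun x => st x = H).card := by
    intro H hH
    rw [hcnt H hH, ← Set.ncard_coe_finset]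
    congr 1
    ext
    simp
  have h1 : ∀ d, ∑ᶠ (H : Subgroup Γ) (_ : Nat.card H = d), (cnt H : ℚ) =
      ∑ H ∈ univ.filter fun H : Subgroup Γ => Nat.card H = d, (cnt H : ℚ) := fun d =>
    finsum_cond_eq_sum_of_cond_iff _ fun _ => by simp
  have h2 : ∑ x ∈ X, ((Nat.card (st x) : ℚ) - 1) =
      ∑ x ∈ X with 1 < Nat.card (st x), ((Nat.card (st x) : ℚ) - 1) := by
    refine (sum_filter_of_ne fun x _ hx => ?_).symm
    by_contra hlt
    have : Nat.card (st x) = 1 := le_antisymm (not_lt.1 hlt) Nat.card_pos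
    exact hx (by rw [this]; simp)
  rw [h2, ← sum_fiberwise_of_maps_to (t := D.divisors.filter (1 < ·))
    (g := fun x => Nat.card (st x)) fun x hx => by
      have := mem_filter.1 hx
      simp [hst x this.1, hD, this.2]]
  refine sum_congr rfl fun d hd => ?_
  obtain ⟨hd1, hd2⟩ := mem_filter.1 hd
  rw [h1, ← sum_fiberwise_of_maps_to (t := univ.filter fun H : Subgroup Γ => Nat.card H = d)
    (g := st) fun x hx => by simp [(mem_filter.1 hx).2], mul_sum]
  refine sum_congr rfl fun H hH => ?_
  have hH' : Nat.card H = d := (mem_filter.1 hH).2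
  rw [hcnt' H (hH' ▸ Nat.dvd_of_mem_divisors hd1),
    sum_congr rfl (g := fun _ => (d : ℚ) - 1) fun x hx => by
      rw [(mem_filter.1 (mem_filter.1 hx).1).2], sum_const, nsmul_eq_mul, mul_comm]
  congr 3
  ext x
  simp only [mem_filter]
  constructor
  · rintro ⟨hx, rfl⟩
    exact ⟨⟨⟨hx, hH' ▸ hd2⟩, hH'⟩, rfl⟩
  · rintro ⟨⟨⟨hx, -⟩, -⟩, h⟩
    exact ⟨hx, h⟩

-- Points whose stabilizer contains `H` are split by its order `d`. The lowest order `|H|` forces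
-- the stabilizer to be `H`; the top order `D` is kept apart because its counts are known in closed
-- form.
open Finset in
theorem card_le_stabilizer_eq {α Γ : Type*} [CommGroup Γ] [Finite Γ] (X : Finset α)
    (st : α → Subgroup Γ) {D : ℕ} (hD : D ≠ 0) (hst : ∀ x ∈ X, Nat.card (st x) ∣ D)
    (cnt : Subgroup Γ → ℕ)
    (hcnt : ∀ H : Subgroup Γ, Nat.card H ∣ D → cnt H = {x | x ∈ X ∧ st x = H}.ncard)
    (H : Subgroup Γ) (hH : Nat.card H ∣ D) (hlt : Nat.card H < D) :
    {x | x ∈ X ∧ H ≤ st x}.ncard = cnt H +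
      (∑ d ∈ D.divisors with Nat.card H < d ∧ d < D,
        ∑ᶠ (K : Subgroup Γ) (_ : Nat.card K = d ∧ H ≤ K), cnt K) +
      ∑ᶠ (K : Subgroup Γ) (_ : Nat.card K = D ∧ H ≤ K), cnt K := by
  classical
  have := Fintype.ofFinite (Subgroup Γ)
  have hcnt' : ∀ H : Subgroup Γ, Nat.card H ∣ D → cnt H = (X.filter fun x => st x = H).card := by
    intro H hH
    rw [hcnt H hH, ← Set.ncard_coe_finset]
    congr 1
    ext
    simp
  have h1 : ∀ d, ∑ᶠ (K : Subgroup Γ) (_ : Nat.card K = d ∧ H ≤ K), cnt K =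
      ∑ K ∈ univ.filter fun K : Subgroup Γ => Nat.card K = d ∧ H ≤ K, cnt K := fun d =>
    finsum_cond_eq_sum_of_cond_iff _ fun _ => by simp
  have h2 : ∀ d, d ∣ D → ∑ K ∈ univ.filter fun K : Subgroup Γ => Nat.card K = d ∧ H ≤ K, cnt K =
      (X.filter fun x => Nat.card (st x) = d ∧ H ≤ st x).card := by
    intro d hd
    rw [card_eq_sum_card_fiberwise
      (t := univ.filter fun K : Subgroup Γ => Nat.card K = d ∧ H ≤ K) (f := st)
      fun x hx => by simpa using (mem_filter.1 (mem_coe.1 hx)).2]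
    refine sum_congr rfl fun K hK => ?_
    have hK' := (mem_filter.1 hK).2
    rw [hcnt' K (hK'.1 ▸ hd)]
    congr 1
    ext x
    simp only [mem_filter]
    constructor
    · rintro ⟨hx, rfl⟩
      exact ⟨⟨hx, hK'⟩, rfl⟩
    · rintro ⟨⟨hx, -⟩, h⟩
      exact ⟨hx, h⟩
  have h3 : {x | x ∈ X ∧ H ≤ st x}.ncard = (X.filter fun x => H ≤ st x).card := by
    rw [← Set.ncard_coe_finset]
    congr 1
    ext
    simp
  have h4 : cnt H = (X.filter fun x => Nat.card (st x) = Nat.card H ∧ H ≤ st x).card := by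
    rw [hcnt' H hH]
    congr 1
    ext x
    simp only [mem_filter]
    refine and_congr_right fun _ => ⟨by rintro rfl; exact ⟨rfl, le_rfl⟩, fun h => ?_⟩
    exact (Subgroup.eq_of_le_of_card_ge h.2 h.1.le).symm
  have h5 : insert (Nat.card H) (insert D (D.divisors.filter fun d => Nat.card H < d ∧ d < D)) =
      D.divisors.filter fun d => Nat.card H ≤ d := by
    ext d
    simp only [mem_insert, mem_filter, Nat.mem_divisors]
    constructor
    · rintro (rfl | rfl | h)
      · exact ⟨⟨hH, hD⟩, le_rfl⟩
      · exact ⟨⟨dvd_rfl, hD⟩, hlt.le⟩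
      · exact ⟨h.1, h.2.1.le⟩
    · rintro ⟨h, h'⟩
      have := Nat.le_of_dvd (Nat.pos_of_ne_zero hD) h.1
      by_cases hd1 : d = Nat.card H
      · exact Or.inl hd1
      · by_cases hd2 : d = D
        · exact Or.inr (Or.inl hd2)
        · exact Or.inr (Or.inr ⟨h, by omega, by omega⟩)
  have h6 : (X.filter fun x => H ≤ st x).card = ∑ d ∈ D.divisors with Nat.card H ≤ d,
      (X.filter fun x => Nat.card (st x) = d ∧ H ≤ st x).card := by
    rw [card_eq_sum_card_fiberwise (t := D.divisors.filter fun d => Nat.card H ≤ d)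
      (f := fun x => Nat.card (st x)) fun x hx => by
        have hx' := mem_filter.1 (mem_coe.1 hx)
        have := Subgroup.card_le_of_le hx'.2
        simp [hst x hx'.1, hD, this]]
    refine sum_congr rfl fun d _ => ?_
    congr 1
    ext x
    simp only [mem_filter]
    tauto
  rw [h3, h6, ← h5, sum_insert (by simp [hlt.ne]), sum_insert (by simp), ← h4,
    h1, h2 D dvd_rfl, add_comm (#_), ← add_assoc]
  congr 2
  exact sum_congr rfl fun d hd => by
    rw [h1, h2 d (Nat.dvd_of_mem_divisors (mem_filter.1 hd).1)]

end Counting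

/-! ### Sorted sequences up to translation -/

section Translation

variable {Γ : Type*} {m : ℕ} {r : Γ → ℕ}

/-- Sequences that are non-decreasing when their entries are compared through `r`. -/
def SortedBy (r : Γ → ℕ) (s : Fin m → Γ) : Prop :=
  Monotone fun i => r (s i)

theorem exists_sortedBy_mult_eq (r : Γ → ℕ) (s : Fin m → Γ) :
    ∃ t : Fin m → Γ, SortedBy r t ∧ mult t = mult s :=
  ⟨s ∘ Tuple.sort fun i => r (s i), Tuple.monotone_sort fun i => r (s i), mult_comp_perm _ _⟩

/-- Equal multiplicities make `s` a rearrangement of `t`; sorting determines the values of `r`, and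
`r` is injective. -/
theorem SortedBy.eq_of_mult_eq (hr : Function.Injective r) {s t : Fin m → Γ} (hs : SortedBy r s)
    (ht : SortedBy r t) (hst : mult s = mult t) : s = t := by
  obtain ⟨σ, hσ⟩ := exists_perm_of_ncard_fiber fun c => congrFun hst c
  have h2 : (fun i => r (t i)) ∘ σ = fun i => r (s i) := by
    funext i
    exact congrArg r (hσ i)
  have h3 := Tuple.unique_monotone (f := fun i => r (t i)) (σ := σ) (τ := Equiv.refl _)
    (by rw [h2]; exact hs) ht
  funext i
  apply hr
  rw [h2] at h3
  exact congrFun h3 i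

variable [CommGroup Γ]

/-- The multiplicities of `s` are a translate of those of `t`. -/
def IsTranslate (s t : Fin m → Γ) : Prop :=
  ∃ a : Γ, ∀ g, mult s g = mult t (a * g)

/-- The translates of `s` among the sorted sequences with `1` in the first position. -/
def translates [NeZero m] (r : Γ → ℕ) (s : Fin m → Γ) : Set (Fin m → Γ) :=
  {t | SortedBy r t ∧ t 0 = 1 ∧ IsTranslate s t}

/-- The sorted sequences with `1` in the first position and `N` distinct entries. -/
def normalized [NeZero m] (r : Γ → ℕ) (N : ℕ) : Set (Fin m → Γ) :=
  {s | SortedBy r s ∧ s 0 = 1 ∧ (Set.range s).ncard = N}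

/-- The sorted sequences with `N` distinct entries whose set of entries contains `H` and whose
multiplicities are constant on the cosets of `H`. -/
def periodic (r : Γ → ℕ) (H : Subgroup Γ) (N : ℕ) : Set (Fin m → Γ) :=
  {s | SortedBy r s ∧ (Set.range s).ncard = N ∧ (H : Set Γ) ⊆ Set.range s ∧
    (∃ C : Set (Γ ⧸ H), Set.range s = (fun g : Γ => (g : Γ ⧸ H)) ⁻¹' C) ∧
    ∀ a ∈ Set.range s, ∀ b ∈ Set.range s, (a : Γ ⧸ H) = (b : Γ ⧸ H) →
      {i | s i = a}.ncard = {i | s i = b}.ncard}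

/-- The members of `periodic r H N` with exactly `N / |H|` translates. -/
def exactlyPeriodic [NeZero m] (r : Γ → ℕ) (H : Subgroup Γ) (N : ℕ) : Set (Fin m → Γ) :=
  {s | s ∈ periodic r H N ∧ (translates r s).ncard = N / Nat.card H}

theorem SortedBy.zero_eq_one_iff [NeZero m] (hr : Function.Injective r) (hmin : ∀ g, r 1 ≤ r g)
    {s : Fin m → Γ} (hs : SortedBy r s) : s 0 = 1 ↔ mult s 1 ≠ 0 := by
  rw [mult_ne_zero_iff]
  constructor
  · exact fun h => ⟨0, h⟩
  · rintro ⟨i, hi⟩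
    have h2 : r (s 0) ≤ r (s i) := hs (Fin.zero_le _)
    rw [hi] at h2
    exact hr (le_antisymm h2 (hmin _))

theorem exists_sortedBy_translate (r : Γ → ℕ) (s : Fin m → Γ) (a : Γ) :
    ∃ t : Fin m → Γ, SortedBy r t ∧ ∀ g, mult t g = mult s (a * g) := by
  obtain ⟨t, h1, h2⟩ := exists_sortedBy_mult_eq r fun i => a⁻¹ * s i
  exact ⟨t, h1, fun g => by rw [h2, mult_mul_left]⟩

theorem IsTranslate.refl (s : Fin m → Γ) : IsTranslate s s :=
  ⟨1, fun g => by rw [one_mul]⟩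

theorem IsTranslate.symm {s t : Fin m → Γ} : IsTranslate s t → IsTranslate t s := by
  rintro ⟨a, ha⟩
  exact ⟨a⁻¹, fun g => by rw [ha, mul_inv_cancel_left]⟩

theorem IsTranslate.trans {s t u : Fin m → Γ} :
    IsTranslate s t → IsTranslate t u → IsTranslate s u := by
  rintro ⟨a, ha⟩ ⟨b, hb⟩
  exact ⟨b * a, fun g => by rw [ha, hb, mul_assoc]⟩

theorem IsTranslate.ncard_range_eq {s t : Fin m → Γ} :
    IsTranslate s t → (Set.range s).ncard = (Set.range t).ncard := by
  rintro ⟨a, ha⟩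
  refine Nat.card_congr ((Equiv.mulLeft a).subtypeEquiv fun g => ?_)
  rw [← mult_ne_zero_iff, ha, mult_ne_zero_iff]
  rfl

/-- Translation is an equivalence relation; this form is the partition hypothesis of
`ncard_image_eq_sum`. -/
theorem mem_translates_iff [NeZero m] {s t : Fin m → Γ} :
    t ∈ translates r s ↔ (SortedBy r t ∧ t 0 = 1) ∧ translates r t = translates r s := by
  constructor
  · rintro ⟨h1, h2, h3⟩
    refine ⟨⟨h1, h2⟩, Set.ext fun u => ?_⟩
    exact ⟨fun ⟨hu1, hu2, hu3⟩ => ⟨hu1, hu2, h3.trans hu3⟩,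
      fun ⟨hu1, hu2, hu3⟩ => ⟨hu1, hu2, h3.symm.trans hu3⟩⟩
  · rintro ⟨⟨h1, h2⟩, h3⟩
    rw [← h3]
    exact ⟨h1, h2, IsTranslate.refl t⟩

/-- The coset conditions say that multiplicities are constant on cosets of `H`, inside and outside
the set of entries. Given this, `H` consists of entries exactly when `1` is an entry, which for a
sorted sequence puts `1` first. -/
theorem periodic_eq [NeZero m] (hr : Function.Injective r) (hmin : ∀ g, r 1 ≤ r g)
    (H : Subgroup Γ) (N : ℕ) :
    periodic (m := m) r H N = {s | s ∈ normalized r N ∧ H ≤ stab s} := by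
  ext s
  constructor
  · rintro ⟨h1, h2, h3, ⟨C, hC⟩, h5⟩
    have h6 : s 0 = 1 := by
      rw [h1.zero_eq_one_iff hr hmin, mult_ne_zero_iff]
      exact h3 H.one_mem
    refine ⟨⟨h1, h6, h2⟩, fun a ha g => ?_⟩
    have hmk : ((a * g : Γ) : Γ ⧸ H) = (g : Γ ⧸ H) := by
      rw [QuotientGroup.eq, mul_comm a g, mul_inv_rev, inv_mul_cancel_right]
      exact H.inv_mem ha
    have hiff : a * g ∈ Set.range s ↔ g ∈ Set.range s := by
      rw [hC, Set.mem_preimage, Set.mem_preimage, hmk]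
    by_cases hg : g ∈ Set.range s
    · exact h5 _ (hiff.2 hg) _ hg hmk
    · have h7 : mult s g = 0 := by rwa [← mult_ne_zero_iff, not_not] at hg
      rw [← hiff, ← mult_ne_zero_iff, not_not] at hg
      rw [h7, hg]
  · rintro ⟨⟨h1, h2, h3⟩, h4⟩
    refine ⟨h1, h3, fun a ha => ?_, ⟨(fun g : Γ => (g : Γ ⧸ H)) '' Set.range s, ?_⟩,
      fun a _ b _ hab => mult_eq_of_mk_eq h4 hab⟩
    · have := h4 ha 1
      rw [mul_one] at this
      rw [← mult_ne_zero_iff, this, ← h1.zero_eq_one_iff hr hmin]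
      exact h2
    · refine (Set.subset_preimage_image _ _).antisymm ?_
      rintro g ⟨g', hg', hgg'⟩
      rw [← mult_ne_zero_iff] at hg' ⊢
      rwa [← mult_eq_of_mk_eq h4 hgg']

theorem cast_ncard_classes_eq_sum [NeZero m] {N : ℕ} (X : Finset (Fin m → Γ))
    (hX : normalized r N = (X : Set (Fin m → Γ))) :
    ((translates r '' (normalized r N : Set (Fin m → Γ))).ncard : ℚ) =
      ∑ s ∈ X, 1 / ((translates r s).ncard : ℚ) := by
  rw [hX]
  refine ncard_image_eq_sum X _ fun s hs u => ?_
  have hmem : ∀ v, v ∈ X ↔ v ∈ normalized r N := fun v => by rw [hX]; simp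
  rw [hmem] at hs ⊢
  rw [mem_translates_iff]
  constructor
  · rintro ⟨hu, h⟩
    refine ⟨⟨hu.1, hu.2, ?_⟩, h⟩
    rw [← hs.2.2]
    exact (mem_translates_iff.2 ⟨hu, h⟩).2.2.ncard_range_eq.symm
  · rintro ⟨hu, h⟩
    exact ⟨⟨hu.1, hu.2.1⟩, h⟩

variable [Finite Γ]

/-- The size of a class is the index of the stabilizer in the set of entries. -/
theorem ncard_translates_mul_card_stab [NeZero m] (hr : Function.Injective r) (hmin : ∀ g, r 1 ≤ r g)
    (s : Fin m → Γ) :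
    (translates r s).ncard * Nat.card (stab s) = (Set.range s).ncard := by
  classical
  have := Fintype.ofFinite Γ
  -- `τ a` is the sorted translate of `s` that moves `a` to `1`; it starts with `1` exactly when `a`
  -- is an entry of `s`.
  choose τ hτ1 hτ2 using exists_sortedBy_translate r s
  have hfin : (translates r s).Finite := Set.toFinite _
  have hmaps : Set.MapsTo τ ((Set.range s).toFinset : Finset Γ) hfin.toFinset := by
    intro a ha
    simp only [Set.coe_toFinset] at ha
    simp only [Set.Finite.coe_toFinset]
    refine ⟨hτ1 a, ?_, ⟨a⁻¹, fun g => ?_⟩⟩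
    · rw [(hτ1 a).zero_eq_one_iff hr hmin, hτ2, mul_one, mult_ne_zero_iff]
      exact ha
    · rw [hτ2, mul_inv_cancel_left]
  rw [Set.ncard_eq_toFinset_card' (Set.range s), Finset.card_eq_sum_card_fiberwise hmaps,
    Set.ncard_eq_toFinset_card _ hfin, ← smul_eq_mul, ← Finset.sum_const]
  refine Finset.sum_congr rfl fun t ht => ?_
  rw [Set.Finite.mem_toFinset] at ht
  obtain ⟨ht1, ht2, ht3⟩ := ht
  obtain ⟨b, hb⟩ := ht3
  -- By `hb`, `τ a = t` holds exactly when `a * b` stabilizes `s`, so every fiber of `τ` is a coset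
  -- of `stab s`.
  have hfib : {a ∈ (Set.range s).toFinset | τ a = t} =
      (Finset.univ.filter fun a => a ∈ stab s).image (· * b⁻¹) := by
    ext a
    simp only [Finset.mem_filter, Set.mem_toFinset, Finset.mem_image, Finset.mem_univ, true_and]
    constructor
    · rintro ⟨-, rfl⟩
      refine ⟨a * b, fun g => ?_, by simp⟩
      rw [hb g, hτ2, mul_assoc]
    · rintro ⟨c, hc, rfl⟩
      have hm : ∀ g, mult s (c * b⁻¹ * g) = mult t g := by
        intro g
        rw [mul_assoc, hc, hb, mul_inv_cancel_left]
      refine ⟨?_, (hτ1 _).eq_of_mult_eq hr ht1 (funext fun g => by rw [hτ2, hm])⟩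
      rw [← mult_ne_zero_iff]
      have := hm 1
      rw [mul_one] at this
      rw [this, ← ht1.zero_eq_one_iff hr hmin]
      exact ht2
  rw [hfib, Finset.card_image_of_injective _ (mul_left_injective b⁻¹), Nat.card_eq_fintype_card,
    Fintype.card_subtype]


/-- An `H`-invariant multiplicity function descends to `Γ ⧸ H`, where its mass is `m / |H|` and its
support has `N / |H|` points, the identity among them. -/
theorem ncard_periodic [NeZero m] (hr : Function.Injective r) (hmin : ∀ g, r 1 ≤ r g)
    (H : Subgroup Γ) {N : ℕ} (hN : 1 ≤ N) (hNm : N ≤ m) (hHN : Nat.card H ∣ N) (hHm : Nat.card H ∣ m) :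
    (periodic (m := m) r H N).ncard = t (Nat.card Γ) m N (Nat.card H) := by
  classical
  have := Fintype.ofFinite Γ
  have := Fintype.ofFinite (Γ ⧸ H)
  have hpos : 0 < Nat.card H := Nat.card_pos
  have hQ : Nat.card (Γ ⧸ H) = Nat.card Γ / Nat.card H := by
    rw [Subgroup.card_eq_card_quotient_mul_card_subgroup H, Nat.mul_div_cancel _ hpos]
  rw [t, ← hQ, ← ncard_massFunctions (1 : Γ ⧸ H)
    (Nat.div_pos (Nat.le_of_dvd hN hHN) hpos) (Nat.div_le_div_right hNm), periodic_eq hr hmin]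
  have hout : ∀ s : Fin m → Γ, H ≤ stab s → ∀ g : Γ,
      mult s ((g : Γ ⧸ H).out) = mult s g := fun s hs g =>
    mult_eq_of_mk_eq hs (Quotient.out_eq' _)
  have hsupp : ∀ ν : Γ ⧸ H → ℕ, (Function.support fun g : Γ => ν g).ncard =
      Nat.card H * (Function.support ν).ncard := fun ν =>
    ncard_preimage_mk H (Function.support ν)
  refine Set.ncard_congr (fun s _ c => mult s c.out) ?_ ?_ ?_
  · rintro s ⟨⟨h1, h2, h3⟩, h4⟩
    have hcomp : mult s = fun g : Γ => mult s ((g : Γ ⧸ H).out) :=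
      funext fun g => (hout s h4 g).symm
    refine ⟨?_, ?_, ?_⟩
    · have := sum_comp_mk H fun c => mult s c.out
      rw [Finset.sum_congr rfl fun g _ => hout s h4 g, sum_mult] at this
      exact (Nat.div_eq_of_eq_mul_right hpos this).symm
    · have := hsupp fun c => mult s c.out
      rw [← hcomp, ← range_eq_support_mult, h3] at this
      exact (Nat.div_eq_of_eq_mul_right hpos this).symm
    · change mult s ((1 : Γ) : Γ ⧸ H).out ≠ 0
      rw [hout s h4, ← h1.zero_eq_one_iff hr hmin]
      exact h2
  · rintro s s' ⟨⟨h1, -, -⟩, h4⟩ ⟨⟨h1', -, -⟩, h4'⟩ heq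
    refine h1.eq_of_mult_eq hr h1' (funext fun g => ?_)
    rw [← hout s h4, ← hout s' h4']
    exact congrFun heq _
  · rintro ν ⟨h1, h2, h3⟩
    have hsum : ∑ g : Γ, ν g = m := by
      rw [sum_comp_mk H, h1, Nat.mul_div_cancel' hHm]
    obtain ⟨u, hu⟩ := exists_mult_eq hsum
    obtain ⟨s, hs1, hs2⟩ := exists_sortedBy_mult_eq r u
    have hs3 : mult s = fun g : Γ => ν g := hs2.trans hu
    refine ⟨s, ⟨⟨hs1, ?_, ?_⟩, fun a ha g => ?_⟩, funext fun c => ?_⟩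
    · rw [hs1.zero_eq_one_iff hr hmin, hs3]
      exact h3
    · rw [range_eq_support_mult, hs3, hsupp, h2, Nat.mul_div_cancel' hHN]
    · rw [hs3]
      refine congrArg ν ?_
      rw [QuotientGroup.eq, mul_comm a g, mul_inv_rev, inv_mul_cancel_right]
      exact H.inv_mem ha
    · rw [hs3]
      exact congrArg ν (Quotient.out_eq' c)

/-- A class of size `N / |H|`, which is positive, forces `|stab s| = |H|`; together with `H ≤ stab
s` this is equality. -/
theorem exactlyPeriodic_eq [NeZero m] (hr : Function.Injective r) (hmin : ∀ g, r 1 ≤ r g)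
    (H : Subgroup Γ) {N : ℕ} (hN : 1 ≤ N) (hHN : Nat.card H ∣ N) :
    exactlyPeriodic (m := m) r H N = {s | s ∈ normalized r N ∧ stab s = H} := by
  have hpos : ∀ K : Subgroup Γ, 0 < Nat.card K := fun K => Nat.card_pos
  ext s
  rw [exactlyPeriodic, periodic_eq hr hmin]
  constructor
  · rintro ⟨⟨h1, h2⟩, h3⟩
    refine ⟨h1, (Subgroup.eq_of_le_of_card_ge h2 ?_).symm⟩
    have h4 := ncard_translates_mul_card_stab hr hmin s
    rw [h1.2.2, h3] at h4
    have h5 : 0 < N / Nat.card H := Nat.div_pos (Nat.le_of_dvd hN hHN) (hpos H)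
    exact (Nat.eq_of_mul_eq_mul_left h5 (h4.trans (Nat.div_mul_cancel hHN).symm)).le
  · rintro ⟨h1, rfl⟩
    refine ⟨⟨h1, le_rfl⟩, ?_⟩
    have h4 := ncard_translates_mul_card_stab hr hmin s
    rw [h1.2.2] at h4
    exact (Nat.div_eq_of_eq_mul_left (hpos _) h4.symm).symm

/-- The number of classes is a sum of reciprocal class sizes over sequences, which splits according
to the number of distinct entries. -/
theorem ncard_classes_eq_sum [NeZero m] (r : Γ → ℕ) :
    (translates r '' {s : Fin m → Γ | SortedBy r s ∧ s 0 = 1}).ncard =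
      ∑ N ∈ Finset.Icc 1 (min m (Nat.card Γ)),
        (translates r '' (normalized r N : Set (Fin m → Γ))).ncard := by
  classical
  have := Fintype.ofFinite Γ
  let Y : Finset (Fin m → Γ) := Finset.univ.filter fun s => SortedBy r s ∧ s 0 = 1
  have hY : {s : Fin m → Γ | SortedBy r s ∧ s 0 = 1} = Y := by
    ext
    simp [Y]
  have hX : ∀ N, normalized r N =
      ((Y.filter fun s => (Set.range s).ncard = N : Finset (Fin m → Γ)) : Set (Fin m → Γ)) := by
    intro N
    ext
    simp [Y, normalized, and_assoc]
  rw [hY, ← Nat.cast_inj (R := ℚ),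
    ncard_image_eq_sum Y _ fun s _ u => by rw [mem_translates_iff]; simp [Y],
    Nat.cast_sum, ← Finset.sum_fiberwise_of_maps_to
      (t := Finset.Icc 1 (min m (Nat.card Γ))) (g := fun s => (Set.range s).ncard)]
  · exact Finset.sum_congr rfl fun N _ => (cast_ncard_classes_eq_sum _ (hX N)).symm
  · intro s _
    rw [Finset.mem_Icc, le_min_iff]
    refine ⟨(Set.ncard_pos).2 ⟨s 0, 0, rfl⟩, ?_, Set.ncard_le_card _⟩
    rw [← Set.image_univ]
    refine (Set.ncard_image_le).trans ?_
    simp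

theorem ncard_classes_formula [NeZero m] (hr : Function.Injective r) (hmin : ∀ g, r 1 ≤ r g)
    {N : ℕ} (hN : N ∈ Finset.Icc 1 (min m (Nat.card Γ))) :
    ((translates r '' (normalized r N : Set (Fin m → Γ))).ncard : ℚ) =
        ((Nat.choose (Nat.card Γ - 1) (N - 1) * Nat.choose (m - 1) (N - 1) : ℕ) : ℚ) / N +
        1 / N * (∑ d ∈ (Nat.gcd (Nat.gcd m N) (Nat.card Γ)).divisors with 1 < d,
          ((d : ℚ) - 1) * (∑ᶠ (H : Subgroup Γ) (_ : Nat.card H = d),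
            ((exactlyPeriodic (m := m) r H N).ncard : ℚ))) ∧
      (∀ H : Subgroup Γ, Nat.card H = Nat.gcd (Nat.gcd m N) (Nat.card Γ) →
        (exactlyPeriodic (m := m) r H N).ncard = t (Nat.card Γ) m N (Nat.card H)) ∧
      (∀ H : Subgroup Γ, Nat.card H ∣ Nat.gcd (Nat.gcd m N) (Nat.card Γ) →
        Nat.card H < Nat.gcd (Nat.gcd m N) (Nat.card Γ) →
          ((exactlyPeriodic (m := m) r H N).ncard : ℤ) = t (Nat.card Γ) m N (Nat.card H) -
            (∑ d ∈ (Nat.gcd (Nat.gcd m N) (Nat.card Γ)).divisors with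
                Nat.card H < d ∧ d < Nat.gcd (Nat.gcd m N) (Nat.card Γ),
              ∑ᶠ (K : Subgroup Γ) (_ : Nat.card K = d ∧ H ≤ K),
                ((exactlyPeriodic (m := m) r K N).ncard : ℤ)) -
            {K : Subgroup Γ | Nat.card K = Nat.gcd (Nat.gcd m N) (Nat.card Γ) ∧ H ≤ K}.ncard *
              t (Nat.card Γ) m N (Nat.gcd (Nat.gcd m N) (Nat.card Γ))) := by
  classical
  have := Fintype.ofFinite (Subgroup Γ)
  obtain ⟨hN1, hN2⟩ := Finset.mem_Icc.1 hN
  have hNm : N ≤ m := hN2.trans (min_le_left _ _)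
  set D := Nat.gcd (Nat.gcd m N) (Nat.card Γ) with hDdef
  have hD0 : D ≠ 0 := (Nat.gcd_pos_of_pos_right _ Nat.card_pos).ne'
  have hDm : D ∣ m := (Nat.gcd_dvd_left _ _).trans (Nat.gcd_dvd_left _ _)
  have hDN : D ∣ N := (Nat.gcd_dvd_left _ _).trans (Nat.gcd_dvd_right _ _)
  have hfin : (normalized (m := m) r N).Finite := Set.toFinite _
  set X := hfin.toFinset with hXdef
  have hX : normalized (m := m) r N = X := by simp [hXdef]
  have hmem : ∀ s, s ∈ X ↔ s ∈ normalized (m := m) r N := fun s => by rw [hXdef, Set.Finite.mem_toFinset]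
  -- The order of `stab s` divides `N` by the class size formula, `m` by summing over cosets, and
  -- `|Γ|` by Lagrange.
  have hst : ∀ s ∈ X, Nat.card (stab s) ∣ D := by
    intro s hs
    have h1 := ncard_translates_mul_card_stab hr hmin s
    rw [((hmem s).1 hs).2.2] at h1
    exact Nat.dvd_gcd (Nat.dvd_gcd (natCard_dvd_of_le_stab le_rfl) ⟨_, by rw [← h1, mul_comm]⟩)
      (Subgroup.card_subgroup_dvd_card _)
  have hcnt : ∀ H : Subgroup Γ, Nat.card H ∣ D →
      (exactlyPeriodic (m := m) r H N).ncard = {s | s ∈ X ∧ stab s = H}.ncard := by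
    intro H hH
    rw [exactlyPeriodic_eq hr hmin H hN1 (hH.trans hDN)]
    simp only [hmem]
  have hSt : ∀ H : Subgroup Γ, Nat.card H ∣ D →
      {s | s ∈ X ∧ H ≤ stab s}.ncard = t (Nat.card Γ) m N (Nat.card H) := by
    intro H hH
    rw [← ncard_periodic hr hmin H hN1 hNm (hH.trans hDN) (hH.trans hDm), periodic_eq hr hmin]
    simp only [hmem]
  -- No stabilizer has order above `D`, so containing an `H` of order `D` already means being equal
  -- to it.
  have htop : ∀ H : Subgroup Γ, Nat.card H = D →
      (exactlyPeriodic (m := m) r H N).ncard = t (Nat.card Γ) m N (Nat.card H) := by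
    intro H hH
    rw [← hSt H hH.dvd, hcnt H hH.dvd]
    congr 1
    ext s
    refine and_congr_right fun hs => ⟨fun h => h.ge, fun h => ?_⟩
    exact (Subgroup.eq_of_le_of_card_ge h
      (hH ▸ Nat.le_of_dvd (Nat.pos_of_ne_zero hD0) (hst s hs))).symm
  refine ⟨?_, htop, fun H hH hlt => ?_⟩
  · have hN0 : (N : ℚ) ≠ 0 := by
      rw [Nat.cast_ne_zero]
      omega
    have hcard : (X.card : ℚ) = ((Nat.choose (Nat.card Γ - 1) (N - 1) *
        Nat.choose (m - 1) (N - 1) : ℕ) : ℚ) := by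
      -- For the trivial subgroup the condition `H ≤ stab s` is vacuous, so all normalized sequences
      -- are counted.
      have h1 := hSt ⊥ (by simp)
      rw [Subgroup.card_bot, t, Nat.div_one, Nat.div_one, Nat.div_one] at h1
      rw [← h1, ← Set.ncard_coe_finset]
      congr 2
      ext s
      simp
    have hT : ∑ s ∈ X, 1 / ((translates r s).ncard : ℚ) =
        ∑ s ∈ X, (1 + ((Nat.card (stab s) : ℚ) - 1)) / N := by
      refine Finset.sum_congr rfl fun s hs => ?_
      have h1 := ncard_translates_mul_card_stab hr hmin s
      rw [((hmem s).1 hs).2.2] at h1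
      have h2 : ((translates r s).ncard : ℚ) * Nat.card (stab s) = N := by exact_mod_cast h1
      have h3 : ((translates r s).ncard : ℚ) ≠ 0 := fun h0 => hN0 (by rw [← h2, h0, zero_mul])
      rw [add_sub_cancel, div_eq_div_iff h3 hN0, one_mul, ← h2, mul_comm]
    rw [sum_card_sub_one_eq X stab hD0 hst (fun H => (exactlyPeriodic (m := m) r H N).ncard) hcnt,
      cast_ncard_classes_eq_sum X hX, hT, ← Finset.sum_div, Finset.sum_add_distrib, ← hcard]
    simp only [Finset.sum_const, nsmul_eq_mul, mul_one]
    ring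
  · have hB := card_le_stabilizer_eq X stab hD0 hst
      (fun H => (exactlyPeriodic (m := m) r H N).ncard) hcnt H hH hlt
    rw [hSt H hH] at hB
    have hlast : ∑ᶠ (K : Subgroup Γ) (_ : Nat.card K = D ∧ H ≤ K),
        (exactlyPeriodic (m := m) r K N).ncard =
        {K : Subgroup Γ | Nat.card K = D ∧ H ≤ K}.ncard * t (Nat.card Γ) m N D := by
      rw [finsum_cond_eq_sum_of_cond_iff (t := Finset.univ.filter
          fun K : Subgroup Γ => Nat.card K = D ∧ H ≤ K) _ fun _ => by simp,
        Finset.sum_congr rfl (g := fun _ => t (Nat.card Γ) m N D) fun K hK => by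
          have := (Finset.mem_filter.1 hK).2.1
          rw [htop K this, this],
        Finset.sum_const, smul_eq_mul, ← Set.ncard_coe_finset]
      simp
    have hmid : ∀ d, ∑ᶠ (K : Subgroup Γ) (_ : Nat.card K = d ∧ H ≤ K),
        ((exactlyPeriodic (m := m) r K N).ncard : ℤ) =
        ((∑ᶠ (K : Subgroup Γ) (_ : Nat.card K = d ∧ H ≤ K),
          (exactlyPeriodic (m := m) r K N).ncard : ℕ) : ℤ) := by
      intro d
      rw [finsum_cond_eq_sum_of_cond_iff (t := Finset.univ.filter
          fun K : Subgroup Γ => Nat.card K = d ∧ H ≤ K) _ fun _ => by simp,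
        finsum_cond_eq_sum_of_cond_iff (t := Finset.univ.filter
          fun K : Subgroup Γ => Nat.card K = d ∧ H ≤ K) _ fun _ => by simp, Nat.cast_sum]
    rw [hlast] at hB
    rw [hB, Finset.sum_congr rfl fun d _ => hmid d]
    push_cast
    ring

end Translation

/-! ### From near-vector spaces to sequences in `G` -/

section Classification

variable {p n m : ℕ} {F : Type*} [Field F]

theorem isExponents_rep (h : 1 < p ^ n) (s : Fin m → G p n) :
    IsExponents p n fun i => rep (s i) :=
  fun i => ⟨(rep_spec h (s i)).1, (rep_spec h (s i)).2.1⟩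

theorem exists_scalars_eq [NeZero m] (hp : p.Prime) (hF : Nat.card F = p ^ n)
    (s : Fin m → G p n) : ∃ A : OverField F m, A.1.scalars = seqScalars F s := by
  obtain ⟨ψ, -, hψ⟩ :=
    exists_scalarHom_eq hp hF (isExponents_rep (one_lt_of_natCard hp hF) s)
  exact ⟨⟨ofAut ψ, ψ, rfl⟩, hψ.symm⟩

theorem iso_iff_mult [NeZero m] (hp : p.Prime) (hF : Nat.card F = p ^ n)
    {A B : NearVectorSpace (Fin m → F)} {s t : Fin m → G p n} (hA : A.scalars = seqScalars F s)
    (hB : B.scalars = seqScalars F t) :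
    A.Iso B ↔ ∃ a : G p n, ∀ g, mult s g = mult t (a * g) := by
  have h := one_lt_of_natCard hp hF
  rw [iso_iff_expClass hp hF (isExponents_rep h s) (isExponents_rep h t) hA hB]
  simp only [(rep_spec h _).2.2, mult]

theorem seqRel_iff [NeZero m] (hp : p.Prime) (hF : Nat.card F = p ^ n) {s t : Fin m → G p n} :
    SeqRel F s t ↔ ∃ a : G p n, ∀ g, mult s g = mult t (a * g) := by
  constructor
  · rintro ⟨A, B, hA, hB, h⟩
    exact (iso_iff_mult hp hF hA hB).1 h
  · intro h
    obtain ⟨A, hA⟩ := exists_scalars_eq hp hF s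
    obtain ⟨B, hB⟩ := exists_scalars_eq hp hF t
    exact ⟨A.1, B.1, hA, hB, (iso_iff_mult hp hF hA hB).2 h⟩

theorem seqClass_eq_translates [NeZero m] (hp : p.Prime) (hF : Nat.card F = p ^ n) :
    seqClass F = translates (m := m) (rep : G p n → ℕ) := by
  funext s
  ext t
  exact and_congr_right fun _ => and_congr_right fun _ => seqRel_iff hp hF

theorem rep_one_le (h : 1 < p ^ n) (g : G p n) : rep (1 : G p n) ≤ rep g := by
  rw [rep_one h]
  exact (rep_spec h g).1

/-- Every near-vector space `F^m` over `F` is isomorphic to the one determined by some suitable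
sequence with `1` in the first position. -/
theorem exists_suitable_iso [NeZero m] (hp : p.Prime) (hF : Nat.card F = p ^ n)
    (A : OverField F m) : ∃ s : Fin m → G p n, (Suitable s ∧ s 0 = 1) ∧
      ∀ B : NearVectorSpace (Fin m → F), B.scalars = seqScalars F s → B.Iso A.1 := by
  have h := one_lt_of_natCard hp hF
  obtain ⟨A, ψ, hA⟩ := A
  choose k hk1 hk2 hk3 using fun i => exists_exponent_of_mulEquiv hp hF (ψ i)
  have hA' : A.scalars = expScalars F k := by
    rw [hA]
    refine congrArg Set.range (funext fun α => congrArg diagEnd (funext fun i => hk3 i α))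
  let u : Fin m → G p n := fun i => expClass p n (k i)
  -- Translating so that `u 0` becomes `1` ensures that `1` occurs, hence comes first after sorting.
  obtain ⟨s, hs1, hs2⟩ := exists_sortedBy_translate rep u (u 0)
  refine ⟨s, ⟨hs1, ?_⟩, fun B hB => ?_⟩
  · rw [hs1.zero_eq_one_iff (rep_injective h) (rep_one_le h), hs2, mult_ne_zero_iff]
    exact ⟨0, (mul_one (u 0)).symm⟩
  · rw [iso_iff_expClass hp hF (isExponents_rep h s) (fun i => ⟨hk1 i, hk2 i⟩) hB hA']
    refine ⟨u 0, fun g => ?_⟩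
    simp only [(rep_spec h _).2.2]
    exact hs2 g

/-- Isomorphism classes and translation classes are both images of the normalized suitable
sequences, under maps that identify the same pairs. -/
theorem numNearVectorSpaces_eq_ncard [NeZero m] (hp : p.Prime) (hF : Nat.card F = p ^ n) :
    numNearVectorSpaces F m =
      (translates rep '' {s : Fin m → G p n | Suitable s ∧ s 0 = 1}).ncard := by
  choose A hA using fun s : Fin m → G p n => exists_scalars_eq (F := F) hp hF s
  let X := {s : Fin m → G p n // Suitable s ∧ s 0 = 1}
  let f : X → Quotient (isoSetoid F m) := fun s => Quotient.mk _ (A s.1)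
  let g : X → Set (Fin m → G p n) := fun s => translates rep s.1
  have hf : Function.Surjective f := by
    intro q
    obtain ⟨B, rfl⟩ := Quotient.exists_rep q
    obtain ⟨s, hs, h⟩ := exists_suitable_iso hp hF B
    exact ⟨⟨s, hs⟩, Quotient.sound (h _ (hA s))⟩
  have hker : Setoid.ker f = Setoid.ker g := by
    ext s t
    rw [Setoid.ker_def, Setoid.ker_def]
    have h1 : f s = f t ↔ IsTranslate s.1 t.1 := by
      rw [IsTranslate, ← iso_iff_mult hp hF (hA s.1) (hA t.1)]
      exact Quotient.eq
    rw [h1]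
    constructor
    · intro h
      exact (mem_translates_iff.1 ⟨t.2.1, t.2.2, h⟩).2.symm
    · intro h
      exact (mem_translates_iff.2 ⟨t.2, h.symm⟩).2.2
  have hrange : translates rep '' {s : Fin m → G p n | Suitable s ∧ s 0 = 1} = Set.range g := by
    rw [Set.image_eq_range]
    rfl
  rw [hrange, numNearVectorSpaces, ← Nat.card_coe_set_eq]
  exact Nat.card_congr ((Setoid.quotientKerEquivOfSurjective f hf).symm.trans
    ((Quotient.congrRight fun s t => by rw [hker]).trans (Setoid.quotientKerEquivRange g)))

end Classification

end NearVec

theorem theorem4p6 (p n : ℕ) (hp : p.Prime) (F : Type*) [Field F] (hF : Nat.card F = p ^ n)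
    (m : ℕ) [NeZero m] :
    NearVec.numNearVectorSpaces F m =
        ∑ N ∈ Finset.Icc 1 (min m (Nat.card (NearVec.G p n))), NearVec.T F p n m N ∧
    ∀ N ∈ Finset.Icc 1 (min m (Nat.card (NearVec.G p n))),
      -- the explicit value of `T(N)`
      (NearVec.T F p n m N : ℚ) =
        ((Nat.choose (Nat.card (NearVec.G p n) - 1) (N - 1) *
            Nat.choose (m - 1) (N - 1) : ℕ) : ℚ) / N +
        1 / N * (∑ d ∈ (Nat.gcd (Nat.gcd m N) (Nat.card (NearVec.G p n))).divisors with 1 < d,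
          ((d : ℚ) - 1) *
            (∑ᶠ (H : Subgroup (NearVec.G p n)) (_ : Nat.card H = d),
              ((NearVec.SBar F H m N).ncard : ℚ))) ∧
      -- the recursion for `|S̄(H)|`, starting from the largest order `d_l = gcd(m, N, |G|)`
      (∀ H : Subgroup (NearVec.G p n),
        Nat.card H = Nat.gcd (Nat.gcd m N) (Nat.card (NearVec.G p n)) →
          (NearVec.SBar F H m N).ncard = NearVec.t (Nat.card (NearVec.G p n)) m N (Nat.card H)) ∧
      (∀ H : Subgroup (NearVec.G p n),
        Nat.card H ∣ Nat.gcd (Nat.gcd m N) (Nat.card (NearVec.G p n)) →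
        Nat.card H < Nat.gcd (Nat.gcd m N) (Nat.card (NearVec.G p n)) →
          ((NearVec.SBar F H m N).ncard : ℤ) =
            NearVec.t (Nat.card (NearVec.G p n)) m N (Nat.card H) -
            (∑ d ∈ (Nat.gcd (Nat.gcd m N) (Nat.card (NearVec.G p n))).divisors with
                Nat.card H < d ∧ d < Nat.gcd (Nat.gcd m N) (Nat.card (NearVec.G p n)),
              ∑ᶠ (K : Subgroup (NearVec.G p n)) (_ : Nat.card K = d ∧ H ≤ K),
                ((NearVec.SBar F K m N).ncard : ℤ)) -
            {K : Subgroup (NearVec.G p n) |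
                Nat.card K = Nat.gcd (Nat.gcd m N) (Nat.card (NearVec.G p n)) ∧ H ≤ K}.ncard *
              NearVec.t (Nat.card (NearVec.G p n)) m N
                (Nat.gcd (Nat.gcd m N) (Nat.card (NearVec.G p n)))) := by
  have h := NearVec.one_lt_of_natCard hp hF
  have := NearVec.finite_G h
  have hSBar : ∀ (H : Subgroup (NearVec.G p n)) (N : ℕ),
      NearVec.SBar F H m N = NearVec.exactlyPeriodic NearVec.rep H N := by
    intro H N
    rw [NearVec.SBar, NearVec.seqClass_eq_translates hp hF]
    rfl
  have hT : ∀ N, NearVec.T F p n m N = (NearVec.translates NearVec.rep ''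
      (NearVec.normalized NearVec.rep N : Set (Fin m → NearVec.G p n))).ncard := by
    intro N
    rw [NearVec.T, NearVec.seqClass_eq_translates hp hF]
    rfl
  simp only [hSBar, hT]
  refine ⟨(NearVec.numNearVectorSpaces_eq_ncard hp hF).trans
    (NearVec.ncard_classes_eq_sum NearVec.rep), fun N hN => ?_⟩
  exact NearVec.ncard_classes_formula (NearVec.rep_injective h) (NearVec.rep_one_le h) hN
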